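/- Let $\mathcal{O}$ be either a complete discrete valuation ring or a field, with maximal ideal $\mathfrak{m}$ and residue field $k=\mathcal{O}/\mathfrak{m}$, where $k$ is algebraically closed of prime characteristic $p$, and let $P$ be a finite $p$-group. For an $\mathcal{O}P$-module $X$ write $X^P$ for its submodule of $P$-fixed points, $\mathrm{Tr}_Q^P : X^Q \to X^P$ for the relative trace from a subgroup $Q$, and let $$\mathrm{Br}_P(X) = X^P \Big/ \Big(\sum_{Q<P} \mathrm{Tr}_Q^P(X^Q) + \mathfrak{m}X^P\Big)$$ be the Brauer quotient, a $k$-vector space. For $\mathcal{O}P$-modules $L, M$ let $P$ (identified with $\Delta P=\{(g,g) : g\in P\}$) act on $\mathrm{Hom}_{\mathcal{O}}(L,M)$ by conjugation, so that $\mathrm{Hom}_{\mathcal{O}}(L,M)^{\Delta P} = \mathrm{Hom}_{\mathcal{O}P}(L,M)$. An $\mathcal{O}P$-module $V$ is an endopermutation module if $\mathrm{End}_{\mathcal{O}}(V)$ is $\mathcal{O}$-free and admits a $\Delta P$-stable basis; two endopermutation modules $V, W$ are compatible if $V\oplus W$ is an endopermutation module. An indecomposable $\mathcal{O}P$-module is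 capped if its vertex is $P$. Let $\mathbf{M}$ be a full subcategory of the category of $\mathcal{O}P$-modules all of whose objects are finitely generated. A functor $Sl : \mathbf{M} \to {}_k\mathbf{Mod}$ is called a $P$-slash functor if, for any two objects $L, M$ of $\mathbf{M}$, the map $\mathrm{Hom}_{\mathcal{O}P}(L,M) \to \mathrm{Hom}_k(Sl(L),Sl(M))$, $u\mapsto Sl(u)$, is the composite of the projection $\mathrm{Hom}_{\mathcal{O}P}(L,M)\to \mathrm{Br}_{\Delta P}(\mathrm{Hom}_{\mathcal{O}}(L,M))$ and an isomorphism of $k$-vector spaces $$\mathrm{Br}_{\Delta P}(\mathrm{Hom}_{\mathcal{O}}(L,M)) \xrightarrow{\sim} \mathrm{Hom}_k(Sl(L),Sl(M)).$$ **Lemma 11.** Assume that any two capped indecomposable direct summands of objects of $\mathbf{M}$ are compatible endopermutation $\mathcal{O}P$-modules. Then: (i) there exists a $P$-slash functor $Sl_P : \mathbf{M}\to {}_k\mathbf{Mod}$; (ii) any two $P$-slash functors $Sl, Sl' : \mathbf{M}\to {}_k\mathbf{Mod}$ are isomorphic as functors, and the isomorphism is unique up to scalar multiplication: for any two isomorphisms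 of functors $\xi,\xi' : Sl \xrightarrow{\sim} Sl'$ there is $c\in k^\times$ with $\xi' = c\,\xi$. -/

import Mathlib

open CategoryTheory

universe u v w

noncomputable section

namespace Slash

section Brauer

variable {O : Type u} [CommRing O] {G : Type v} [Group G]
  {V : Type w} [AddCommGroup V] [Module O V]

/-- The submodule `V ^ Q` of `Q`-fixed points of an `O[G]`-module, for a subgroup `Q` of `G`. -/
abbrev fixedPoints (ρ : Representation O G V) (Q : Subgroup G) : Submodule O V :=
  Representation.invariants (ρ.comp Q.subtype)

lemma apply_out (ρ : Representation O G V) (Q : Subgroup G) {m : V}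
    (hm : m ∈ fixedPoints ρ Q) (x : G) : ρ ((x : G ⧸ Q).out) m = ρ x m := by
  obtain ⟨h, hh⟩ := QuotientGroup.mk_out_eq_mul Q x
  rw [hh, map_mul, Module.End.mul_apply]
  congr 1
  exact hm h

/-- The relative trace map `V ^ Q → V ^ G`, `m ↦ ∑ x m`, where `x` runs through a set of
representatives of the cosets `G / Q`. -/
def relTrace [Finite G] (ρ : Representation O G V) (Q : Subgroup G) :
    fixedPoints ρ Q →ₗ[O] ρ.invariants :=
  letI : Fintype (G ⧸ Q) := Fintype.ofFinite _
  LinearMap.codRestrict ρ.invariants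
    ((∑ x : G ⧸ Q, ρ x.out) ∘ₗ (fixedPoints ρ Q).subtype) (by
      intro m g
      simp only [LinearMap.comp_apply, Submodule.subtype_apply, LinearMap.sum_apply, map_sum]
      refine Fintype.sum_equiv (MulAction.toPerm g) _ _ fun x => ?_
      have hx : MulAction.toPerm g x = ((g * x.out : G) : G ⧸ Q) := by
        conv_lhs => rw [← QuotientGroup.out_eq' x]
        rfl
      rw [hx, apply_out ρ Q m.2, map_mul, Module.End.mul_apply])

variable [IsLocalRing O] [Finite G]

/-- The submodule `∑_{Q < G} Tr_Q^G (V ^ Q) + 𝔪 V ^ G` of `V ^ G`. -/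
def brauerKernel (ρ : Representation O G V) : Submodule O ρ.invariants :=
  (⨆ Q : {Q : Subgroup G // Q < ⊤}, LinearMap.range (relTrace ρ Q.1)) ⊔
    (IsLocalRing.maximalIdeal O • (⊤ : Submodule O ρ.invariants))

/-- The Brauer quotient `Br_G(V)` of an `O[G]`-module `V`. -/
abbrev BrauerQuotient (ρ : Representation O G V) : Type w :=
  ρ.invariants ⧸ brauerKernel ρ

lemma isTorsionBySet_brauerQuotient (ρ : Representation O G V) :
    Module.IsTorsionBySet O (BrauerQuotient ρ) (IsLocalRing.maximalIdeal O : Set O) := by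
  intro x a
  obtain ⟨m, rfl⟩ := Submodule.mkQ_surjective _ x
  change (a : O) • (brauerKernel ρ).mkQ m = 0
  rw [← map_smul, Submodule.mkQ_apply, Submodule.Quotient.mk_eq_zero]
  exact Submodule.mem_sup_right (Submodule.smul_mem_smul a.2 trivial)

/-- The Brauer quotient is a vector space over the residue field `k` of `O`; the scalar
multiplication is induced by that of `O`. -/
instance (ρ : Representation O G V) :
    Module (IsLocalRing.ResidueField O) (BrauerQuotient ρ) :=
  (isTorsionBySet_brauerQuotient ρ).module

lemma residue_smul_brauerQuotient (ρ : Representation O G V) (a : O) (x : BrauerQuotient ρ) :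
    IsLocalRing.residue O a • x = a • x := rfl

/-- The Brauer map `br_G : V ^ G → Br_G(V)`. -/
def brauerMap (ρ : Representation O G V) : ρ.invariants →ₗ[O] BrauerQuotient ρ :=
  (brauerKernel ρ).mkQ

end Brauer

section Modules

variable {O : Type u} [CommRing O] {G : Type v} [Group G]

/-- `V` is relatively `Q`-projective: it is (isomorphic to) a direct summand of `Ind_Q^G W` for
some `O[Q]`-module `W`. -/
def IsRelProjective (V : Rep.{w} O G) (Q : Subgroup G) : Prop :=
  ∃ (W : Rep.{w} O Q)
    (i : V.ρ.IntertwiningMap (W.ρ.ind Q.subtype))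
    (r : (W.ρ.ind Q.subtype).IntertwiningMap V.ρ),
    ∀ x, r (i x) = x

/-- The subgroup `Q` is a vertex of `V`: it is minimal among the subgroups relative to which `V`
is projective. -/
def IsVertex (V : Rep.{w} O G) (Q : Subgroup G) : Prop :=
  Minimal (IsRelProjective V) Q

/-- `V` is capped: the whole group is a vertex of `V`. -/
def IsCapped (V : Rep.{w} O G) : Prop :=
  IsVertex V ⊤

/-- `V` is an endopermutation module: the `O`-module `End_O(V)` has an `O`-basis that is stable
under the conjugation action of `G`. -/
def IsEndopermutation (V : Rep.{w} O G) : Prop :=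
  ∃ (ι : Type w) (b : Module.Basis ι O (V →ₗ[O] V)),
    ∀ (g : G) (i : ι), ∃ j : ι, Representation.linHom V.ρ V.ρ g (b i) = b j

/-- `V` and `W` are compatible endopermutation modules: `V`, `W` and `V ⊕ W` are
endopermutation modules. -/
def AreCompatibleEndopermutation (V W : Rep.{w} O G) : Prop :=
  IsEndopermutation V ∧ IsEndopermutation W ∧ IsEndopermutation (Rep.of (V.ρ.prod W.ρ))

/-- `V` is (isomorphic to) a capped indecomposable direct summand of an object of the full
subcategory of `O[G]`-modules defined by `𝓜`. -/
def IsCappedIndecomposableSummand (𝓜 : ObjectProperty (Rep.{w} O G)) (V : Rep.{w} O G) : Prop :=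
  Indecomposable V ∧ IsCapped V ∧ ∃ L : Rep.{w} O G, 𝓜 L ∧ Nonempty (Retract V L)

/-- A `G`-slash functor on the full subcategory of `O[G]`-modules defined by `𝓜` (for `G` a finite
`p`-group): a functor `Sl` to vector spaces over the residue field `k` such that, for any objects
`L`, `M`, the map `Hom_{OG}(L, M) → Hom_k(Sl L, Sl M)`, `u ↦ Sl u`, is the composite of
the Brauer map `Hom_{OG}(L, M) = Hom_O(L, M) ^ G → Br_G(Hom_O(L, M))` and an isomorphism
`Br_G(Hom_O(L, M)) ≃ Hom_k(Sl L, Sl M)`. -/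
def IsSlashFunctor [IsLocalRing O] [Finite G] {𝓜 : ObjectProperty (Rep.{w} O G)}
    (Sl : 𝓜.FullSubcategory ⥤ ModuleCat.{w} (IsLocalRing.ResidueField O)) : Prop :=
  ∀ L M : 𝓜.FullSubcategory,
    ∃ e : BrauerQuotient (Representation.linHom L.obj.ρ M.obj.ρ)
        ≃ₗ[IsLocalRing.ResidueField O] (Sl.obj L →ₗ[IsLocalRing.ResidueField O] Sl.obj M),
      ∀ u : L ⟶ M,
        (Sl.map u).hom = e (brauerMap (Representation.linHom L.obj.ρ M.obj.ρ)
          ((Representation.linHom.invariantsEquivRepHom L.obj M.obj).symm u.hom))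

end Modules

end Slash

end

noncomputable section

namespace Slash

/-! ### Relative traces and sums over finite `G`-sets -/

section BrauerNull

variable {O : Type*} [CommRing O] {G : Type*} [Group G]
  {V W : Type*} [AddCommGroup V] [Module O V] [AddCommGroup W] [Module O W]

/-! Call an `O[G]`-map negligible if it vanishes in the Brauer quotient; these maps form an ideal of
the category. The heart of the matter is that if `End_O(V)` has a `G`-stable basis, then the Brauer
quotient of `End_O(V)` has no proper nonzero two-sided ideal (`mem_span_mul_mul_sup_brauerNull`).
Indeed `End_O(V)` is Azumaya, so every `O`-linear endomorphism of it is a combination of maps `x ↦ b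
i * x * b j`, and modulo traces only the fixed pairs `(i, j)` matter.

Let `V` be capped, indecomposable and endopermutation. Its endomorphism ring is local, and by
Higman's criterion negligible endomorphisms are nonunits. A negligible-free nonunit cannot exist,
since it would generate `1` modulo nonunits; as `k` is algebraically closed, `End(V)` is therefore
scalar modulo negligible maps. If `W` is compatible with `V`, the same simplicity applied to `V ⊕ W`
and to the projection onto `V` writes `id_W`, modulo negligible maps, as a sum of maps through `V`.
Summands that are not capped have negligible identity. So, modulo negligible maps, every object of
`𝓜` is built from copies of one `V` (`exists_generator`), and `M ↦ Br(Hom_O(V, M))` is a slash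
functor.

For uniqueness, a slash functor reaches every linear map between its values, including those of rank
one. Two such functors have Hom spaces identified compatibly with composition, and rank-one maps
recover the vector spaces from these; an automorphism commuting with all rank-one maps is one common
scalar. -/

lemma map_mem_invariants {ρ : Representation O G V} {σ : Representation O G W} {T : V →ₗ[O] W}
    (hT : ∀ g x, T (ρ g x) = σ g (T x)) {x : V} (hx : x ∈ ρ.invariants) : T x ∈ σ.invariants :=
  fun g => by rw [← hT, hx g]

lemma map_mem_fixedPoints {ρ : Representation O G V} {σ : Representation O G W} {T : V →ₗ[O] W}
    (hT : ∀ g x, T (ρ g x) = σ g (T x)) {Q : Subgroup G} {x : V} (hx : x ∈ fixedPoints ρ Q) :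
    T x ∈ fixedPoints σ Q :=
  fun g => by
    rw [MonoidHom.comp_apply, ← hT]
    exact congrArg T (hx g)

variable [Finite G]

lemma relTrace_apply (ρ : Representation O G V) (Q : Subgroup G) [Fintype (G ⧸ Q)]
    (m : fixedPoints ρ Q) : (relTrace ρ Q m : V) = ∑ x : G ⧸ Q, ρ x.out (m : V) := by
  have h : (relTrace ρ Q m : V) = (∑ x : G ⧸ Q, ρ x.out : V →ₗ[O] V) (m : V) := by
    change (Finset.sum (@Finset.univ _ (Fintype.ofFinite _)) _ : V →ₗ[O] V) (m : V) = _
    congr!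
  rw [h, LinearMap.sum_apply]

lemma map_relTrace {ρ : Representation O G V} {σ : Representation O G W} {T : V →ₗ[O] W}
    (hT : ∀ g x, T (ρ g x) = σ g (T x)) {Q : Subgroup G} (m : fixedPoints ρ Q) :
    T (relTrace ρ Q m : V) = relTrace σ Q ⟨T m, map_mem_fixedPoints hT m.2⟩ := by
  let _ : Fintype (G ⧸ Q) := Fintype.ofFinite _
  rw [relTrace_apply, relTrace_apply, map_sum]
  exact Finset.sum_congr rfl fun x _ => hT _ _

variable [IsLocalRing O]

/-- The image in `V` of the submodule `∑_{Q < G} Tr_Q^G (V ^ Q) + 𝔪 V ^ G` of `V ^ G`. -/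
def brauerNull (ρ : Representation O G V) : Submodule O V :=
  (brauerKernel ρ).map ρ.invariants.subtype

lemma coe_mem_brauerNull {ρ : Representation O G V} {x : ρ.invariants} :
    (x : V) ∈ brauerNull ρ ↔ x ∈ brauerKernel ρ := by
  simp [brauerNull]

lemma relTrace_mem_brauerNull (ρ : Representation O G V) {Q : Subgroup G} (hQ : Q < ⊤)
    (m : fixedPoints ρ Q) : (relTrace ρ Q m : V) ∈ brauerNull ρ :=
  coe_mem_brauerNull.2 <| Submodule.mem_sup_left <|
    Submodule.mem_iSup_of_mem (⟨Q, hQ⟩ : {Q : Subgroup G // Q < ⊤}) ⟨m, rfl⟩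

lemma smul_mem_brauerNull (ρ : Representation O G V) {a : O}
    (ha : a ∈ IsLocalRing.maximalIdeal O) {x : V} (hx : x ∈ ρ.invariants) :
    a • x ∈ brauerNull ρ :=
  coe_mem_brauerNull (x := a • ⟨x, hx⟩).2 <|
    Submodule.mem_sup_right (Submodule.smul_mem_smul ha trivial)

lemma brauerNull_le {ρ : Representation O G V} {N : Submodule O V}
    (h₁ : ∀ (Q : Subgroup G) (_ : Q < ⊤) (m : fixedPoints ρ Q), (relTrace ρ Q m : V) ∈ N)
    (h₂ : ∀ a ∈ IsLocalRing.maximalIdeal O, ∀ x ∈ ρ.invariants, a • x ∈ N) :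
    brauerNull ρ ≤ N := by
  rw [brauerNull, Submodule.map_le_iff_le_comap, brauerKernel, sup_le_iff, iSup_le_iff,
    Submodule.smul_le]
  refine ⟨?_, fun a ha x _ => h₂ a ha x x.2⟩
  rintro ⟨Q, hQ⟩ _ ⟨m, rfl⟩
  exact h₁ Q hQ m

lemma brauerNull_le_invariants (ρ : Representation O G V) : brauerNull ρ ≤ ρ.invariants := by
  rintro _ ⟨x, -, rfl⟩
  exact x.2

lemma map_mem_brauerNull {ρ : Representation O G V} {σ : Representation O G W} {T : V →ₗ[O] W}
    (hT : ∀ g x, T (ρ g x) = σ g (T x)) {x : V} (hx : x ∈ brauerNull ρ) :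
    T x ∈ brauerNull σ := by
  suffices h : brauerNull ρ ≤ (brauerNull σ).comap T from h hx
  refine brauerNull_le (fun Q hQ m => ?_) fun a ha x hx => ?_
  · rw [Submodule.mem_comap, map_relTrace hT]
    exact relTrace_mem_brauerNull σ hQ _
  · rw [Submodule.mem_comap, map_smul]
    exact smul_mem_brauerNull σ ha (map_mem_invariants hT hx)

open MulAction in
-- The sum over an orbit is the relative trace, from the stabilizer of a representative, of the
-- value there. A proper stabilizer gives a negligible term, and a full one means a fixed point,
-- where `f` vanishes.
lemma sum_mem_brauerNull (ρ : Representation O G V) {X : Type*} [MulAction G X] [Fintype X]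
    (f : X → V) (hf : ∀ g x, f (g • x) = ρ g (f x)) (h₀ : ∀ x ∈ MulAction.fixedPoints G X, f x = 0) :
    ∑ x, f x ∈ brauerNull ρ := by
  classical
  let _ : Fintype (orbitRel.Quotient G X) := Fintype.ofFinite _
  let _ (Q : Subgroup G) : Fintype (G ⧸ Q) := Fintype.ofFinite _
  rw [← (selfEquivSigmaOrbitsQuotientStabilizer G X).symm.sum_comp, Fintype.sum_sigma]
  refine Submodule.sum_mem _ fun ω _ => ?_
  have key : ∀ y : G ⧸ stabilizer G ω.out,
      f ((selfEquivSigmaOrbitsQuotientStabilizer G X).symm ⟨ω, y⟩) = ρ y.out (f ω.out) := by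
    intro y
    rw [← hf]
    conv_lhs => rw [← QuotientGroup.out_eq' y]
    rfl
  simp only [key]
  by_cases hQ : stabilizer G ω.out = ⊤
  · rw [h₀ ω.out fun g => by rw [← mem_stabilizer_iff, hQ]; trivial]
    simp
  · have hm : f ω.out ∈ Slash.fixedPoints ρ (stabilizer G ω.out) := fun g => by
      change ρ g (f ω.out) = _
      rw [← hf, mem_stabilizer_iff.1 g.2]
    rw [← relTrace_apply ρ _ ⟨_, hm⟩]
    exact relTrace_mem_brauerNull ρ (lt_top_iff_ne_top.2 hQ) _

open MulAction in
/-- Modulo relative traces, the sum of an equivariant function on a finite `G`-set is the sum of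
its values at the fixed points. -/
lemma sum_sub_sum_fixedPoints_mem_brauerNull (ρ : Representation O G V) {X : Type*}
    [MulAction G X] [Fintype X] [DecidablePred (· ∈ MulAction.fixedPoints G X)]
    (f : X → V) (hf : ∀ g x, f (g • x) = ρ g (f x)) :
    ∑ x, f x - ∑ x with x ∈ MulAction.fixedPoints G X, f x ∈ brauerNull ρ := by
  rw [Finset.sum_filter, ← Finset.sum_sub_distrib]
  refine sum_mem_brauerNull ρ (fun x => f x - if x ∈ MulAction.fixedPoints G X then f x else 0)
    (fun g x => ?_) fun x hx => by simp [hx]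
  have : g • x ∈ MulAction.fixedPoints G X ↔ x ∈ MulAction.fixedPoints G X := by
    constructor
    · intro h
      have h' := h g⁻¹
      rw [inv_smul_smul] at h'
      rwa [h']
    · intro h
      rwa [h g]
  simp only [this, map_sub, hf]
  split_ifs <;> simp

end BrauerNull

/-! ### Permutation bases -/

section PermutationBasis

variable {O : Type*} [CommRing O] {G : Type*} [Group G] {V : Type*} [AddCommGroup V] [Module O V]
  {ι : Type*}

/-- Over a nontrivial ring a basis is injective, so the index `j` is determined by `g` and `i`, and
the action axioms are inherited from `ρ`. -/
lemma exists_mulAction_basis [Nontrivial O] (ρ : Representation O G V) (b : Module.Basis ι O V)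
    (hb : ∀ g i, ∃ j, ρ g (b i) = b j) :
    ∃ _ : MulAction G ι, ∀ (g : G) (i : ι), ρ g (b i) = b (g • i) := by
  choose s hs using hb
  exact ⟨{ smul := s
           one_smul := fun i => b.injective <| by
            change b (s 1 i) = _
            rw [← hs, map_one, Module.End.one_apply]
           mul_smul := fun g h i => b.injective <| by
            change b (s (g * h) i) = b (s g (s h i))
            rw [← hs, ← hs, ← hs, map_mul, Module.End.mul_apply] }, hs⟩

variable [MulAction G ι]

lemma coord_smul (ρ : Representation O G V) (b : Module.Basis ι O V)
    (hb : ∀ (g : G) (i : ι), ρ g (b i) = b (g • i)) (g : G) (x : V) (i : ι) :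
    b.coord (g • i) (ρ g x) = b.coord i x := by
  classical
  suffices h : b.coord (g • i) ∘ₗ ρ g = b.coord i from LinearMap.congr_fun h x
  refine b.ext fun j => ?_
  simp [hb, Finsupp.single_apply, (MulAction.injective g).eq_iff]

variable [Finite G] [IsLocalRing O]

lemma sub_sum_fixedPoints_coord_mem_brauerNull [Fintype ι]
    [DecidablePred (· ∈ MulAction.fixedPoints G ι)] (ρ : Representation O G V)
    (b : Module.Basis ι O V) (hb : ∀ (g : G) (i : ι), ρ g (b i) = b (g • i)) {x : V}
    (hx : x ∈ ρ.invariants) :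
    x - ∑ i with i ∈ MulAction.fixedPoints G ι, b.coord i x • b i ∈ brauerNull ρ := by
  have h := sum_sub_sum_fixedPoints_mem_brauerNull ρ (fun i => b.coord i x • b i) fun g i => by
    rw [(ρ g).map_smul, hb]
    congr 1
    conv_lhs => rw [← hx g]
    exact coord_smul ρ b hb g x i
  rwa [show ∑ i, b.coord i x • b i = x from b.sum_repr x] at h

end PermutationBasis

/-! ### Simplicity of the Brauer quotient of an endomorphism algebra -/

section Simple

open TensorProduct

variable {O : Type*} [CommRing O] {G : Type*} [Group G] {V : Type*} [AddCommGroup V] [Module O V]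

lemma linHom_mul (ρ : Representation O G V) (g : G) (x y : Module.End O V) :
    ρ.linHom ρ g (x * y) = ρ.linHom ρ g x * ρ.linHom ρ g y := by
  ext v
  simp [Representation.linHom_apply]

lemma isAzumaya_end [Nontrivial V] [Module.Free O V] [Module.Finite O V] :
    IsAzumaya O (Module.End O V) := by
  classical
  let b := Module.Free.chooseBasis O V
  have : Nonempty (Module.Free.ChooseBasisIndex O V) := b.index_nonempty
  have := IsAzumaya.matrix O (Module.Free.ChooseBasisIndex O V)
  exact IsAzumaya.of_AlgEquiv O _ _ (algEquivMatrix b).symm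

/-- The Azumaya isomorphism from `E ⊗ Eᵐᵒᵖ` to `End_O(E)`, for `E = End_O(V)`, carries the tensor
product basis to these maps. When `G` permutes `b`, it permutes them diagonally. -/
lemma exists_basis_mul_mul [Nontrivial V] [Module.Free O V] [Module.Finite O V] {ι : Type*}
    (b : Module.Basis ι O (Module.End O V)) :
    ∃ β : Module.Basis (ι × ι) O (Module.End O (Module.End O V)),
      ∀ q x, β q x = b q.1 * x * b q.2 := by
  have hbij : Function.Bijective (AlgHom.mulLeftRight O (Module.End O V)) :=
    (isAzumaya_end (O := O) (V := V)).bij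
  refine ⟨(b.tensorProduct (b.map (MulOpposite.opLinearEquiv O))).map
    (LinearEquiv.ofBijective (AlgHom.mulLeftRight O (Module.End O V)).toLinearMap hbij),
    fun q x => ?_⟩
  simp only [Module.Basis.map_apply, Module.Basis.tensorProduct_apply']
  exact AlgHom.mulLeftRight_apply _ _ _ _ _

variable [Finite G] [IsLocalRing O]

/-- If `End_O(V)` has a `G`-stable basis, then a fixed point which is nonzero in the Brauer
quotient generates the Brauer quotient as a two-sided ideal. -/
theorem mem_span_mul_mul_sup_brauerNull [Module.Free O V] [Module.Finite O V]
    (ρ : Representation O G V) {ι : Type*} (b : Module.Basis ι O (Module.End O V))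
    (hb : ∀ g i, ∃ j, ρ.linHom ρ g (b i) = b j) {a c : Module.End O V}
    (ha : a ∈ (ρ.linHom ρ).invariants) (ha' : a ∉ brauerNull (ρ.linHom ρ))
    (hc : c ∈ (ρ.linHom ρ).invariants) :
    c ∈ Submodule.span O {z | ∃ x ∈ (ρ.linHom ρ).invariants, ∃ y ∈ (ρ.linHom ρ).invariants,
      z = x * a * y} ⊔ brauerNull (ρ.linHom ρ) := by
  classical
  obtain ⟨_, hb⟩ := exists_mulAction_basis _ b hb
  have : Finite ι := Module.Finite.finite_basis b
  let _ : Fintype ι := Fintype.ofFinite ι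
  set σ := ρ.linHom ρ
  set N := Submodule.span O {z | ∃ x ∈ σ.invariants, ∃ y ∈ σ.invariants, z = x * a * y} ⊔
    brauerNull σ
  have hinv : ∀ i ∈ MulAction.fixedPoints G ι, b i ∈ σ.invariants := fun i hi g => by
    rw [hb, hi g]
  -- Modulo traces, `a` is the combination of its fixed basis elements; if all their coefficients
  -- were in the maximal ideal, `a` would vanish in the Brauer quotient.
  obtain ⟨i₀, hi₀, hu⟩ : ∃ i ∈ MulAction.fixedPoints G ι, IsUnit (b.coord i a) := by
    by_contra! h
    refine ha' ?_
    rw [← sub_add_cancel a (∑ i with i ∈ MulAction.fixedPoints G ι, b.coord i a • b i)]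
    refine add_mem (sub_sum_fixedPoints_coord_mem_brauerNull σ b hb ha) (sum_mem fun i hi => ?_)
    have hi := (Finset.mem_filter.1 hi).2
    exact smul_mem_brauerNull σ ((IsLocalRing.mem_maximalIdeal _).2 (h i hi)) (hinv i hi)
  have : Nontrivial V := by
    by_contra h
    rw [not_nontrivial_iff_subsingleton] at h
    exact ha' (by rw [Subsingleton.elim a 0]; exact zero_mem _)
  obtain ⟨β, hβ⟩ := exists_basis_mul_mul b
  have hβ' : ∀ (g : G) (q : ι × ι), σ.linHom σ g (β q) = β (g • q) := fun g q => by
    ext1 x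
    rw [Representation.linHom_apply, LinearMap.comp_apply, LinearMap.comp_apply, hβ, hβ,
      linHom_mul, linHom_mul, hb, hb, Representation.self_inv_apply]
    rfl
  have hfix : ∀ j ∈ MulAction.fixedPoints G ι, b j ∈ N := by
    intro j hj
    -- This `G`-equivariant rank-one map sends `a` to a unit multiple of `b j`. Expanding it in `β`
    -- expresses `b j` through products `b q.1 * a * b q.2`; modulo traces only the fixed pairs `q`
    -- survive.
    let ε : Module.End O (Module.End O V) := (b.coord i₀).smulRight (b j)
    have hε : ε ∈ (σ.linHom σ).invariants := fun g => by
      ext1 x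
      rw [Representation.linHom_apply, LinearMap.comp_apply, LinearMap.comp_apply]
      simp only [ε, LinearMap.smulRight_apply, map_smul]
      rw [hb, hj g, ← coord_smul σ b hb g (σ g⁻¹ x) i₀, hi₀ g, Representation.self_inv_apply]
    have hsum : ε a = ∑ q : ι × ι, β.coord q ε • (b q.1 * a * b q.2) := by
      conv_lhs => rw [← β.sum_repr ε]
      rw [LinearMap.sum_apply]
      refine Finset.sum_congr rfl fun q _ => ?_
      rw [LinearMap.smul_apply, hβ, Module.Basis.coord_apply]
    have h := sum_sub_sum_fixedPoints_mem_brauerNull σ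
      (fun q : ι × ι => β.coord q ε • (b q.1 * a * b q.2)) fun g q => by
        rw [map_smul, linHom_mul, linHom_mul, hb, hb, show ρ.linHom ρ g a = a from ha g]
        congr 1
        conv_lhs => rw [← hε g]
        exact coord_smul _ β hβ' g ε q
    rw [← hsum] at h
    have h' : ε a ∈ N := by
      rw [← sub_add_cancel (ε a)]
      refine add_mem (Submodule.mem_sup_right h) (sum_mem fun q hq => ?_)
      have hq := (Finset.mem_filter.1 hq).2
      refine Submodule.smul_mem _ _ (Submodule.mem_sup_left (Submodule.subset_span
        ⟨b q.1, hinv _ fun g => congrArg Prod.fst (hq g), b q.2,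
          hinv _ fun g => congrArg Prod.snd (hq g), rfl⟩))
    obtain ⟨u, hu⟩ := hu
    have : b j = (↑u⁻¹ : O) • ε a := by
      simp only [ε, LinearMap.smulRight_apply, ← hu, smul_smul, Units.inv_mul, one_smul]
    rw [this]
    exact Submodule.smul_mem _ _ h'
  rw [← sub_add_cancel c (∑ i with i ∈ MulAction.fixedPoints G ι, b.coord i c • b i)]
  refine add_mem (Submodule.mem_sup_right (sub_sum_fixedPoints_coord_mem_brauerNull σ b hb hc))
    (sum_mem fun i hi => Submodule.smul_mem _ _ (hfix i (Finset.mem_filter.1 hi).2))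

end Simple

/-! ### Local algebras finite over a complete local ring -/

section LocalEnd

open IsLocalRing

variable {O : Type*} [CommRing O] [IsLocalRing O]

/-- Without nontrivial idempotents one-sided inverses are two-sided: if `s * t = 1` then `t * s` is
a nonzero idempotent. A unit `x * a * y` would thus make `a` invertible. -/
lemma mul_mul_mem_nonunits {E : Type*} [Ring E] [Nontrivial E]
    (hE : ∀ e : E, e * e = e → e = 0 ∨ e = 1) {a : E} (ha : a ∈ nonunits E) (x y : E) : x * a * y ∈ nonunits E := by
  have key : ∀ s t : E, s * t = 1 → t * s = 1 := fun s t h => by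
    rcases hE (t * s) (by rw [mul_assoc, ← mul_assoc s, h, one_mul]) with h' | h'
    · have : s * (t * s) * t = 1 := by rw [← mul_assoc, h, one_mul, h]
      rw [h', mul_zero, zero_mul] at this
      exact absurd this zero_ne_one
    · exact h'
  rintro ⟨u, hu⟩
  have h₁ : a * (y * ↑u⁻¹ * x) = 1 := by
    have h : x * (a * y * ↑u⁻¹) = 1 := by rw [← mul_assoc, ← mul_assoc, ← hu, Units.mul_inv]
    have := key _ _ h
    rw [← this]
    noncomm_ring
  exact ha ⟨⟨a, _, h₁, key _ _ h₁⟩, rfl⟩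

/-- A unit in `𝔪E` forces `E = 𝔪E`, hence `E = 0` by Nakayama. -/
lemma maximalIdeal_smul_mem_nonunits {E : Type*} [Ring E] [Algebra O E] [Module.Finite O E]
    [Nontrivial E] {a : E} (ha : a ∈ maximalIdeal O • (⊤ : Submodule O E)) : a ∈ nonunits E := by
  rintro ⟨u, hu⟩
  have h : (⊤ : Submodule O E) ≤ maximalIdeal O • ⊤ := fun z _ => by
    have hz : z = LinearMap.mulLeft O (z * ↑u⁻¹) a := by
      rw [LinearMap.mulLeft_apply, ← hu, mul_assoc, Units.inv_mul, mul_one]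
    rw [hz]
    have := Submodule.mem_map_of_mem (f := LinearMap.mulLeft O (z * ↑u⁻¹)) ha
    rw [Submodule.map_smul''] at this
    exact Submodule.smul_mono le_rfl le_top this
  have := Submodule.eq_bot_of_le_smul_of_le_jacobson_bot _ _ Module.Finite.fg_top h
    (IsLocalRing.maximalIdeal_le_jacobson _)
  exact top_ne_bot this

/-- Over a local ring with algebraically closed residue field, each element of a local
module-finite algebra is a scalar up to a nonunit. -/
lemma exists_sub_algebraMap_mem_nonunits [IsAlgClosed (ResidueField O)] {E : Type*} [Ring E]
    [Algebra O E] [Module.Finite O E] [IsLocalRing E] (a : E) :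
    ∃ c : O, a - algebraMap O E c ∈ nonunits E := by
  obtain ⟨f, hf, hfa⟩ := Algebra.IsIntegral.isIntegral (R := O) a
  by_contra! h
  choose s hs using residue_surjective (R := O)
  -- A lift of the factorization of `f` into linear factors over the residue field. Then `g(a) ≡
  -- f(a) = 0` modulo `𝔪E`, whereas `g(a)` is a unit if every `a - c` is.
  let g : Polynomial O :=
    ((f.map (residue O)).roots.map fun r => Polynomial.X - Polynomial.C (s r)).prod
  have hg : g.map (residue O) = f.map (residue O) := by
    rw [Polynomial.map_multiset_prod, Multiset.map_map]
    simp only [Function.comp_def, Polynomial.map_sub, Polynomial.map_X, Polynomial.map_C, hs]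
    exact ((IsAlgClosed.splits _).eq_prod_roots_of_monic (hf.map _)).symm
  have hunit : IsUnit (Polynomial.aeval a g) := by
    have key : ∀ m : Multiset (ResidueField O), IsUnit (Polynomial.aeval a
        (m.map fun r => Polynomial.X - Polynomial.C (s r)).prod) := fun m => by
      induction m using Multiset.induction with
      | empty => simp
      | cons r m ih =>
        rw [Multiset.map_cons, Multiset.prod_cons, map_mul]
        refine IsUnit.mul ?_ ih
        simpa using h (s r)
    exact key _
  refine maximalIdeal_smul_mem_nonunits (O := O) ?_ hunit
  have hfg : Polynomial.aeval a g = Polynomial.aeval a (g - f) := by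
    rw [map_sub, Polynomial.aeval_def a f, hfa, sub_zero]
  rw [hfg, Polynomial.aeval_eq_sum_range]
  refine Submodule.sum_mem _ fun i _ => Submodule.smul_mem_smul ?_ trivial
  rw [← residue_eq_zero_iff, ← Polynomial.coeff_map, Polynomial.map_sub, hg, sub_self,
    Polynomial.coeff_zero]

variable [IsNoetherianRing O]

/-- For finite `M` the completion is a quotient of `Ô ⊗ M`, and `O → Ô` is already surjective. -/
lemma isAdicComplete_of_finite [IsAdicComplete (maximalIdeal O) O] (M : Type*) [AddCommGroup M]
    [Module O M] [Module.Finite O M] : IsAdicComplete (maximalIdeal O) M := by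
  have : IsPrecomplete (maximalIdeal O) M := by
    refine AdicCompletion.of_surjective_iff.1 fun z => ?_
    obtain ⟨t, rfl⟩ := AdicCompletion.ofTensorProduct_surjective_of_finite (maximalIdeal O) M z
    induction t with
    | zero => exact ⟨0, by simp⟩
    | add s t hs ht =>
      obtain ⟨x, hx⟩ := hs
      obtain ⟨y, hy⟩ := ht
      exact ⟨x + y, by rw [map_add, map_add, hx, hy]⟩
    | tmul r m =>
      obtain ⟨r, rfl⟩ := AdicCompletion.of_surjective (maximalIdeal O) O r
      refine ⟨r • m, ?_⟩
      rw [AdicCompletion.ofTensorProduct_tmul, map_smul]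
      ext n
      simp only [AdicCompletion.smul_eval]
      rfl
  exact ⟨⟩

/-- Fitting's argument in the Artinian ring `S / J` yields an idempotent from a power of `x`. Hensel
lifts it to `S`, where it is `0` (then `x` is nilpotent modulo `J`) or `1` (then `x` is a unit
modulo `J`); units lift since `J` lies in the Jacobson radical. -/
lemma isUnit_or_isUnit_one_sub_of_finite_commRing [IsAdicComplete (maximalIdeal O) O]
    {S : Type*} [CommRing S] [Algebra O S] [Module.Finite O S]
    (hS : ∀ e : S, e * e = e → e = 0 ∨ e = 1) (x : S) : IsUnit x ∨ IsUnit (1 - x) := by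
  set J := (maximalIdeal O).map (algebraMap O S)
  have : IsAdicComplete (maximalIdeal O) S := isAdicComplete_of_finite S
  have : IsAdicComplete J S := (IsAdicComplete.map_algebraMap_iff _ _).2 this
  have hloc := isLocalHom_of_le_jacobson_bot J (IsAdicComplete.le_jacobson_bot J)
  have : IsArtinianRing (S ⧸ J) := by
    let _ : Field (O ⧸ maximalIdeal O) := Ideal.Quotient.field _
    have : Module.Finite (O ⧸ maximalIdeal O) (S ⧸ (maximalIdeal O).map (algebraMap O S)) :=
      Module.Finite.of_restrictScalars_finite O _ _
    exact IsArtinianRing.of_finite (O ⧸ maximalIdeal O) (S ⧸ (maximalIdeal O).map (algebraMap O S))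
  set q := Ideal.Quotient.mk J
  obtain ⟨n, y, hy⟩ := IsArtinian.exists_pow_succ_smul_dvd (q x) (1 : S ⧸ J)
  rw [smul_eq_mul, smul_eq_mul, mul_one] at hy
  have ht : q x ^ n * (q x * y) ^ n = q x ^ n := by
    have h : ∀ m, q x ^ n * (q x * y) ^ m = q x ^ n := fun m => by
      induction m with
      | zero => simp
      | succ m ih =>
        calc q x ^ n * (q x * y) ^ (m + 1) = (q x ^ n * (q x * y) ^ m) * (q x * y) := by ring
          _ = q x ^ n.succ * y := by rw [ih, pow_succ]; ring
          _ = q x ^ n := hy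
    exact h n
  obtain ⟨e₀, he₀⟩ := Ideal.Quotient.mk_surjective (I := J) ((q x * y) ^ n)
  have hidem : q e₀ * q e₀ = q e₀ := by
    rw [he₀]
    calc (q x * y) ^ n * (q x * y) ^ n = y ^ n * (q x ^ n * (q x * y) ^ n) := by ring
      _ = (q x * y) ^ n := by rw [ht]; ring
  obtain ⟨e, he, hee⟩ := HenselianRing.is_henselian (I := J)
    (Polynomial.X ^ 2 - Polynomial.X : Polynomial S)
    (Polynomial.monic_X_pow_sub (Polynomial.degree_X_le.trans_lt (by norm_num))) e₀
    (by
      rw [← Ideal.Quotient.eq_zero_iff_mem]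
      simp only [Polynomial.eval_sub, Polynomial.eval_pow, Polynomial.eval_X, map_sub, map_pow]
      change q e₀ ^ 2 - q e₀ = 0
      rw [sq, hidem, sub_self])
    (by
      -- The derivative of `X ^ 2 - X` at an idempotent is its own inverse: `(2e - 1)² = 1`.
      refine IsUnit.of_mul_eq_one (2 * q e₀ - 1) ?_
      simp only [Polynomial.derivative_X_pow, Polynomial.derivative_X,
        Polynomial.eval_sub, Polynomial.eval_mul, Polynomial.eval_pow, Polynomial.eval_X,
        Polynomial.eval_one, map_sub, map_mul, map_pow, map_one]
      change (_ * q e₀ ^ (2 - 1) - 1) * (2 * q e₀ - 1) = 1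
      simp only [Nat.cast_ofNat, Polynomial.eval_ofNat, map_ofNat]
      linear_combination 4 * hidem)
  have hqe : q e = (q x * y) ^ n := by
    rw [← he₀, ← sub_eq_zero]
    exact (map_sub q e e₀).symm.trans (Ideal.Quotient.eq_zero_iff_mem.2 hee)
  have hee : e * e = e := by
    simpa [Polynomial.IsRoot, sub_eq_zero, sq] using he
  rcases hS e hee with rfl | rfl
  · right
    refine hloc.map_nonunit _ ?_
    rw [map_sub, map_one]
    refine IsNilpotent.isUnit_one_sub ⟨n, ?_⟩
    rw [← ht, ← hqe, map_zero, mul_zero]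
  · left
    refine hloc.map_nonunit _ ?_
    rcases n with _ | n
    · exact IsUnit.of_mul_eq_one y (by simpa using hy)
    · refine isUnit_of_dvd_one ⟨y * (q x * y) ^ n, ?_⟩
      rw [← map_one q, hqe]
      ring

/-- A module-finite algebra without nontrivial idempotents over a complete local ring is local. -/
theorem isLocalRing_of_forall_idempotent [IsAdicComplete (maximalIdeal O) O]
    {E : Type*} [Ring E] [Algebra O E] [Module.Finite O E] [Nontrivial E]
    (hE : ∀ e : E, e * e = e → e = 0 ∨ e = 1) : IsLocalRing E := by
  refine IsLocalRing.of_isUnit_or_isUnit_one_sub_self fun x => ?_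
  -- It suffices to work in the commutative subalgebra `O[x]`, which is finite over `O` and inherits
  -- the absence of idempotents.
  let φ : Polynomial O →ₐ[O] E := Polynomial.aeval x
  let ψ := Ideal.kerLiftAlg φ
  have hψ : Function.Injective ψ := Ideal.kerLiftAlg_injective φ
  have : IsNoetherian O E := isNoetherian_of_isNoetherianRing_of_finite O E
  have : Module.Finite O (Polynomial O ⧸ RingHom.ker φ) :=
    Module.Finite.of_injective ψ.toLinearMap hψ
  have hx : ψ (Ideal.Quotient.mk _ Polynomial.X) = x := Polynomial.aeval_X x
  have h := isUnit_or_isUnit_one_sub_of_finite_commRing (O := O)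
    (S := Polynomial O ⧸ RingHom.ker φ) (fun e he => by
      rcases hE (ψ e) (by rw [← map_mul, he]) with h | h
      · exact Or.inl (hψ (by rw [h, map_zero]))
      · exact Or.inr (hψ (by rw [h, map_one]))) (Ideal.Quotient.mk _ Polynomial.X)
  refine h.imp (fun h => ?_) fun h => ?_
  · simpa only [hx] using h.map ψ
  · simpa only [hx, map_sub, map_one] using h.map ψ

end LocalEnd

open Representation IsLocalRing

open Representation

/-! ### Higman's criterion -/

section Higman

variable {O : Type u} [CommRing O] {G : Type v} [Group G]

/-- The linear map out of an induced representation given by a compatible family of linear maps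
indexed by the group elements. -/
def indLift {A B : Type*} [AddCommGroup A] [Module O A] [AddCommGroup B] [Module O B]
    {Q : Subgroup G} (ρ : Representation O Q A) (f : G → A →ₗ[O] B)
    (hf : ∀ (q : Q) (h : G), f (q * h) ∘ₗ ρ q = f h) : IndV Q.subtype ρ →ₗ[O] B :=
  Coinvariants.lift _ (TensorProduct.lift ((Finsupp.lift _ _ _ f) ∘ₗ
    (MonoidAlgebra.coeffLinearEquiv O).toLinearMap)) fun q => by
      ext h a
      simpa [ofMulAction_single] using LinearMap.congr_fun (hf q h) a

lemma indLift_mk {A B : Type*} [AddCommGroup A] [Module O A] [AddCommGroup B] [Module O B]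
    {Q : Subgroup G} (ρ : Representation O Q A) (f : G → A →ₗ[O] B)
    (hf : ∀ (q : Q) (h : G), f (q * h) ∘ₗ ρ q = f h) (h : G) (a : A) :
    indLift ρ f hf (IndV.mk Q.subtype ρ h a) = f h a := by
  simp [indLift]

lemma indV_mk_mul {A : Type*} [AddCommGroup A] [Module O A]
    {Q : Subgroup G} (ρ : Representation O Q A) (q : Q) (h : G) (a : A) :
    IndV.mk Q.subtype ρ (q * h) (ρ q a) = IndV.mk Q.subtype ρ h a := by
  have := Coinvariants.mk_self_apply (tprod ((leftRegular O G).comp Q.subtype) ρ) q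
    (MonoidAlgebra.single h 1 ⊗ₜ[O] a)
  simpa [ofMulAction_single] using this

lemma linHom_compRight {V W U : Type*} [AddCommGroup V] [Module O V] [AddCommGroup W]
    [Module O W] [AddCommGroup U] [Module O U] {ρ : Representation O G V}
    {σ : Representation O G W} {τ : Representation O G U} (f : IntertwiningMap σ τ) (g : G)
    (x : V →ₗ[O] W) :
    f.toLinearMap.compRight O (ρ.linHom σ g x) =
      ρ.linHom τ g (f.toLinearMap.compRight O x) := by
  ext v
  exact IntertwiningMap.isIntertwining _ _ f g _

lemma linHom_lcomp {V W U : Type*} [AddCommGroup V] [Module O V] [AddCommGroup W]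
    [Module O W] [AddCommGroup U] [Module O U] {ρ : Representation O G V}
    {σ : Representation O G W} {τ : Representation O G U} (f : IntertwiningMap ρ σ) (g : G)
    (x : W →ₗ[O] U) :
    LinearMap.lcomp O U f.toLinearMap (σ.linHom τ g x) =
      ρ.linHom τ g (LinearMap.lcomp O U f.toLinearMap x) := by
  ext v
  exact congrArg (fun y => τ g (x y)) (IntertwiningMap.isIntertwining _ _ f g⁻¹ v).symm

variable [Finite G]

/-- One direction of Higman's criterion. -/
lemma isRelProjective_of_relTrace_eq_id (V : Rep.{w} O G) (Q : Subgroup G)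
    (a : fixedPoints (V.ρ.linHom V.ρ) Q)
    (ha : (relTrace (V.ρ.linHom V.ρ) Q a : V →ₗ[O] V) = LinearMap.id) : IsRelProjective V Q := by
  let ρ : Representation O Q V := V.ρ.comp Q.subtype
  let τ := ρ.ind Q.subtype
  have hf : ∀ (q : Q) (h : G), V.ρ ((q : G) * h)⁻¹ ∘ₗ ρ q = V.ρ h⁻¹ := fun q h => by
    ext x
    simp [ρ]
  -- In the coinvariants model `IndV.mk h x` plays the role of `h⁻¹ ⊗ x`, whence the inverse.
  let r : IntertwiningMap τ V.ρ :=
    ⟨indLift ρ (fun h => V.ρ h⁻¹) hf, fun g => by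
      refine IndV.hom_ext _ _ fun h => LinearMap.ext fun x => ?_
      change indLift ρ _ hf (τ g (IndV.mk Q.subtype ρ h x)) =
        V.ρ g (indLift ρ _ hf (IndV.mk Q.subtype ρ h x))
      rw [ind_mk, indLift_mk, indLift_mk]
      simp⟩
  let m : V →ₗ[O] IndV Q.subtype ρ := IndV.mk Q.subtype ρ 1
  have hma : m ∘ₗ (a : V →ₗ[O] V) ∈ fixedPoints (V.ρ.linHom τ) Q := fun q => by
    ext v
    have hq : V.ρ q ((a : V →ₗ[O] V) (V.ρ (q : G)⁻¹ v)) = (a : V →ₗ[O] V) v :=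
      LinearMap.congr_fun (a.2 q) v
    change τ q (IndV.mk Q.subtype ρ 1 ((a : V →ₗ[O] V) (V.ρ (q : G)⁻¹ v))) =
      IndV.mk Q.subtype ρ 1 ((a : V →ₗ[O] V) v)
    rw [ind_mk, ← hq, one_mul, ← indV_mk_mul ρ q]
    simp [ρ]
  -- Composition with the equivariant `r` commutes with the trace, so `r ∘ i = Tr(r ∘ m ∘ a) = Tr(a)
  -- = id`.
  let i := relTrace (V.ρ.linHom τ) Q ⟨_, hma⟩
  refine ⟨Rep.of ρ, invariantsEquivIntertwiningMap _ _ i, r, fun x => ?_⟩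
  change (r.toLinearMap.compRight O (i : V →ₗ[O] IndV Q.subtype ρ)) x = x
  rw [map_relTrace (linHom_compRight r)]
  have : r.toLinearMap.compRight O (m ∘ₗ (a : V →ₗ[O] V)) = a := by
    ext v
    change indLift ρ _ hf (IndV.mk Q.subtype ρ 1 _) = _
    rw [indLift_mk]
    simp
  simp only [this]
  exact LinearMap.congr_fun ha x

/-- Take for `π` the projection onto the summand `1 ⊗ A`. Its conjugates are the projections onto
the summands `x ⊗ A`, indexed by cosets, and add up to the identity. -/
lemma exists_relTrace_ind_eq_id {A : Type*} [AddCommGroup A] [Module O A] {Q : Subgroup G}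
    (ρ : Representation O Q A) :
    ∃ π : fixedPoints ((ρ.ind Q.subtype).linHom (ρ.ind Q.subtype)) Q,
      (relTrace ((ρ.ind Q.subtype).linHom (ρ.ind Q.subtype)) Q π :
        IndV Q.subtype ρ →ₗ[O] IndV Q.subtype ρ) = LinearMap.id := by
  classical
  let _ : Fintype (G ⧸ Q) := Fintype.ofFinite _
  let f : G → A →ₗ[O] IndV Q.subtype ρ := fun h => if h ∈ Q then IndV.mk Q.subtype ρ h else 0
  have hf : ∀ (q : Q) (h : G), f (q * h) ∘ₗ ρ q = f h := fun q h => by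
    ext a
    by_cases hh : h ∈ Q
    · simpa [f, hh, Q.mul_mem_cancel_left q.2] using indV_mk_mul ρ q h a
    · simp [f, hh, Q.mul_mem_cancel_left q.2]
  let π := indLift ρ f hf
  have hπ : ∀ (g h : G) (a : A), ρ.ind Q.subtype g (π (ρ.ind Q.subtype g⁻¹
      (IndV.mk Q.subtype ρ h a))) = if h * g ∈ Q then IndV.mk Q.subtype ρ h a else 0 := by
    intro g h a
    rw [ind_mk, inv_inv, indLift_mk]
    by_cases hh : h * g ∈ Q
    · simp only [f, hh, if_true]
      rw [ind_mk, mul_inv_cancel_right]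
    · simp [f, hh]
  refine ⟨⟨π, fun q => ?_⟩, ?_⟩
  · refine IndV.hom_ext _ _ fun h => LinearMap.ext fun a => ?_
    refine (hπ q h a).trans ?_
    change _ = indLift ρ f hf (IndV.mk Q.subtype ρ h a)
    rw [indLift_mk, Q.mul_mem_cancel_right q.2]
    by_cases hh : h ∈ Q <;> simp [f, hh]
  · rw [relTrace_apply]
    refine IndV.hom_ext _ _ fun h => LinearMap.ext fun a => ?_
    rw [LinearMap.comp_apply, LinearMap.sum_apply]
    refine (Finset.sum_congr rfl fun x _ => hπ x.out h a).trans ?_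
    have : ∀ x : G ⧸ Q, h * x.out ∈ Q ↔ x = ((h⁻¹ : G) : G ⧸ Q) := fun x => by
      conv_rhs => rw [← QuotientGroup.out_eq' x]
      rw [eq_comm, QuotientGroup.eq, inv_inv]
    simp only [this]
    rw [Finset.sum_ite_eq' Finset.univ, if_pos (Finset.mem_univ _)]
    rfl

/-- The identity of `V` factors as `r ∘ id ∘ i` through the induced module, whose identity is a
trace from `Q`. -/
lemma id_mem_brauerNull_of_isRelProjective [IsLocalRing O] (V : Rep.{w} O G) {Q : Subgroup G}
    (hQ : Q < ⊤) (h : IsRelProjective V Q) :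
    (LinearMap.id : V →ₗ[O] V) ∈ brauerNull (V.ρ.linHom V.ρ) := by
  obtain ⟨W, i, r, hir⟩ := h
  obtain ⟨π, hπ⟩ := exists_relTrace_ind_eq_id W.ρ
  have h₁ := relTrace_mem_brauerNull _ hQ π
  rw [hπ] at h₁
  have h₂ := map_mem_brauerNull (linHom_lcomp i) (map_mem_brauerNull (linHom_compRight r) h₁)
  convert h₂ using 1
  ext x
  exact (hir x).symm

end Higman

open Representation

section EndRing

variable {O : Type*} [CommRing O] {G : Type*} [Group G] {V : Type*} [AddCommGroup V] [Module O V]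

instance (ρ : Representation O G V) : Ring (IntertwiningMap ρ ρ) :=
  { (inferInstance : Semiring (IntertwiningMap ρ ρ)),
    (inferInstance : AddCommGroup (IntertwiningMap ρ ρ)) with }

lemma toLinearMap_mem_invariants {W : Type*} [AddCommGroup W] [Module O W]
    {ρ : Representation O G V} {σ : Representation O G W} (f : IntertwiningMap ρ σ) :
    f.toLinearMap ∈ (ρ.linHom σ).invariants :=
  ((invariantsEquivIntertwiningMap ρ σ).symm f).2

end EndRing

section Top

variable {O : Type u} [CommRing O] {G : Type v} [Group G] [Finite G]

lemma isRelProjective_top (V : Rep.{w} O G) : IsRelProjective V ⊤ := by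
  let _ : Fintype (G ⧸ (⊤ : Subgroup G)) := Fintype.ofFinite _
  let a : fixedPoints (V.ρ.linHom V.ρ) ⊤ :=
    ⟨LinearMap.id, fun g => toLinearMap_mem_invariants (IntertwiningMap.id V.ρ) g⟩
  refine isRelProjective_of_relTrace_eq_id V ⊤ a ?_
  have h : ∀ g : G, V.ρ.linHom V.ρ g (a : V →ₗ[O] V) = LinearMap.id := fun g =>
    toLinearMap_mem_invariants (IntertwiningMap.id V.ρ) g
  have := QuotientGroup.subsingleton_quotient_top (G := G)
  rw [relTrace_apply, Fintype.sum_subsingleton _ ((1 : G) : G ⧸ (⊤ : Subgroup G)), h]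

end Top

/-! ### The ideal of negligible maps -/

section Negligible

variable {O : Type*} [CommRing O] [IsLocalRing O] {G : Type*} [Group G] [Finite G]
  {V W U : Type*} [AddCommGroup V] [Module O V] [AddCommGroup W] [Module O W]
  [AddCommGroup U] [Module O U] {ρ : Representation O G V} {σ : Representation O G W}
  {τ : Representation O G U}

variable (ρ σ) in
/-- The intertwining maps whose image in the Brauer quotient is zero. -/
def negligible : Submodule O (IntertwiningMap ρ σ) :=
  (brauerNull (ρ.linHom σ)).comap (IntertwiningMap.toLinearMapl ρ σ)

lemma comp_mem_negligible (f : IntertwiningMap σ τ) {x : IntertwiningMap ρ σ}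
    (hx : x ∈ negligible ρ σ) : f.comp x ∈ negligible ρ τ :=
  map_mem_brauerNull (linHom_compRight f) hx

lemma mem_negligible_comp {x : IntertwiningMap σ τ} (hx : x ∈ negligible σ τ)
    (f : IntertwiningMap ρ σ) : x.comp f ∈ negligible ρ τ :=
  map_mem_brauerNull (linHom_lcomp f) hx

lemma map_toLinearMapl_negligible :
    (negligible ρ σ).map (IntertwiningMap.toLinearMapl ρ σ) = brauerNull (ρ.linHom σ) := by
  rw [negligible, Submodule.map_comap_eq, inf_eq_right]
  intro x hx
  exact ⟨invariantsEquivIntertwiningMap ρ σ ⟨x, brauerNull_le_invariants _ hx⟩, rfl⟩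

variable (ρ σ) in
/-- The span of the endomorphisms of `σ` that factor through `ρ`. -/
def factorsThrough : Submodule O (IntertwiningMap σ σ) :=
  Submodule.span O {z | ∃ (f : IntertwiningMap ρ σ) (g : IntertwiningMap σ ρ), z = f.comp g}

lemma comp_comp_mem_factorsThrough_sup_negligible {z : IntertwiningMap σ σ}
    (hz : z ∈ factorsThrough ρ σ ⊔ negligible σ σ) (a : IntertwiningMap σ τ)
    (a' : IntertwiningMap τ σ) :
    a.comp (z.comp a') ∈ factorsThrough ρ τ ⊔ negligible τ τ := by
  obtain ⟨x, hx, n, hn, rfl⟩ := Submodule.mem_sup.1 hz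
  rw [IntertwiningMap.comp_add, IntertwiningMap.add_comp]
  refine add_mem (Submodule.mem_sup_left ?_)
    (Submodule.mem_sup_right (comp_mem_negligible a (mem_negligible_comp hn a')))
  clear hz
  induction hx using Submodule.span_induction with
  | mem x hx =>
    obtain ⟨f, g, rfl⟩ := hx
    exact Submodule.subset_span ⟨a.comp f, g.comp a', rfl⟩
  | zero =>
    convert Submodule.zero_mem _
    ext1
    simp
  | add x y _ _ hx hy =>
    rw [IntertwiningMap.comp_add, IntertwiningMap.add_comp]
    exact add_mem hx hy
  | smul c x _ hx =>
    rw [IntertwiningMap.smul_comp, IntertwiningMap.comp_smul]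
    exact Submodule.smul_mem _ _ hx

/-- If `End_O(V)` has a `G`-stable basis, then each endomorphism of `V` which is not negligible
generates the unit ideal modulo negligible endomorphisms. -/
lemma mem_span_mul_mul_sup_negligible [Module.Free O V] [Module.Finite O V] {ι : Type*}
    (b : Module.Basis ι O (V →ₗ[O] V)) (hb : ∀ g i, ∃ j, ρ.linHom ρ g (b i) = b j)
    {a : IntertwiningMap ρ ρ} (ha : a ∉ negligible ρ ρ) (c : IntertwiningMap ρ ρ) :
    c ∈ Submodule.span O {z | ∃ x y : IntertwiningMap ρ ρ, z = x * a * y} ⊔ negligible ρ ρ := by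
  have h := mem_span_mul_mul_sup_brauerNull ρ b hb (toLinearMap_mem_invariants a) ha
    (toLinearMap_mem_invariants c)
  have hmap : Submodule.span O {z | ∃ x ∈ (ρ.linHom ρ).invariants, ∃ y ∈ (ρ.linHom ρ).invariants,
      z = x * a.toLinearMap * y} ⊔ brauerNull (ρ.linHom ρ) ≤
      (Submodule.span O {z | ∃ x y : IntertwiningMap ρ ρ, z = x * a * y} ⊔ negligible ρ ρ).map
        (IntertwiningMap.toLinearMapl ρ ρ) := by
    rw [Submodule.map_sup, map_toLinearMapl_negligible]
    refine sup_le_sup_right (Submodule.span_le.2 ?_) _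
    rintro _ ⟨x, hx, y, hy, rfl⟩
    exact ⟨invariantsEquivIntertwiningMap ρ ρ ⟨x, hx⟩ * a *
      invariantsEquivIntertwiningMap ρ ρ ⟨y, hy⟩, Submodule.subset_span ⟨_, _, rfl⟩, rfl⟩
  obtain ⟨z, hz, hzc⟩ := hmap h
  rwa [← IntertwiningMap.toLinearMap_injective ρ ρ hzc]

end Negligible

/-! ### Freeness of modules with free endomorphism module -/

section Free

/-- A finitely generated module over a principal ideal domain whose endomorphism module is free
is itself free. -/
lemma free_of_free_end {O : Type*} [CommRing O] [IsDomain O] [IsPrincipalIdealRing O]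
    {V : Type*} [AddCommGroup V] [Module O V] [Module.Finite O V]
    [Module.Free O (V →ₗ[O] V)] : Module.Free O V := by
  obtain ⟨s, hs⟩ := Module.projective_lifting_property (Submodule.torsion O V).mkQ
    LinearMap.id (Submodule.mkQ_surjective _)
  obtain ⟨r, hr, hr'⟩ := Submodule.annihilator_top_inter_nonZeroDivisors
    (Submodule.torsion_isTorsion (R := O) (M := V))
  -- The difference `id - s ∘ π` takes values in the torsion submodule, so a nonzero `r` kills it;
  -- the free module `End_O(V)` has no torsion, which makes `V` isomorphic to its torsion-free
  -- quotient.
  have h : r • (LinearMap.id - s ∘ₗ (Submodule.torsion O V).mkQ) = 0 := by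
    ext v
    have hv : v - s ((Submodule.torsion O V).mkQ v) ∈ Submodule.torsion O V := by
      refine (Submodule.Quotient.mk_eq_zero _).1 ?_
      change (Submodule.torsion O V).mkQ _ = 0
      rw [map_sub, sub_eq_zero]
      exact (LinearMap.congr_fun hs _).symm
    exact congrArg Subtype.val (Submodule.mem_annihilator.1 hr ⟨_, hv⟩ trivial)
  rcases smul_eq_zero.1 h with h | h
  · exact absurd h (nonZeroDivisors.ne_zero hr')
  · exact Module.Free.of_equiv (LinearEquiv.ofLinearMap s (Submodule.torsion O V).mkQ
      (sub_eq_zero.1 h).symm hs)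

end Free

/-! ### Idempotents and direct sum decompositions -/

section Indecomposable

open Limits

variable {O : Type u} [CommRing O] {G : Type v} [Group G]

/-- Idempotents split in an abelian category, so `e` and `1 - e` decompose `V` as `Y ⊞ Z`, and one
of the summands is zero. -/
lemma eq_zero_or_one_of_indecomposable {V : Rep.{w} O G} (hV : Indecomposable V)
    (e : IntertwiningMap V.ρ V.ρ) (he : e * e = e) : e = 0 ∨ e = 1 := by
  have split : ∀ p : V ⟶ V, p ≫ p = p → ∃ (Y : Rep.{w} O G) (i : Y ⟶ V) (r : V ⟶ Y),
      i ≫ r = 𝟙 Y ∧ r ≫ i = p := fun p hp =>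
    (Idempotents.isIdempotentComplete_of_abelian (Rep.{w} O G)).idempotents_split V p hp
  let p : V ⟶ V := Rep.ofHom e
  have hp : p ≫ p = p := Rep.hom_ext he
  obtain ⟨Y, i, r, hir, hri⟩ := split p hp
  obtain ⟨Z, j, s, hjs, hsj⟩ := split (𝟙 V - p) (Idempotents.idem_of_id_sub_idem p hp)
  have hps : p ≫ s = 0 := by
    rw [← Category.comp_id s, ← hjs, reassoc_of% hsj, Preadditive.sub_comp, Category.id_comp,
      Preadditive.comp_sub, reassoc_of% hp, sub_self]
  have hjp : j ≫ p = 0 := by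
    rw [← Category.id_comp j, ← hjs, Category.assoc, Category.assoc, reassoc_of% hsj,
      Preadditive.sub_comp, Category.id_comp, hp, sub_self, comp_zero]
  let b : BinaryBicone Y Z :=
    { pt := V, fst := r, snd := s, inl := i, inr := j
      inl_fst := hir
      inl_snd := by
        rw [← Category.id_comp i, ← hir, Category.assoc, Category.assoc, reassoc_of% hri, hps,
          comp_zero]
      inr_fst := by
        rw [← Category.comp_id r, ← hir, reassoc_of% hri, reassoc_of% hjp, zero_comp]
      inr_snd := hjs }
  have hb : b.IsBilimit := isBinaryBilimitOfTotal b (by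
    change r ≫ i + s ≫ j = 𝟙 V
    rw [hri, hsj, add_sub_cancel])
  rcases hV.2 Y Z (biprod.uniqueUpToIso Y Z hb) with h | h
  · left
    have : p = 0 := by rw [← hri, h.eq_of_src i 0, comp_zero]
    exact congrArg Rep.Hom.hom this
  · right
    have : 𝟙 V - p = 0 := by rw [← hsj, h.eq_of_src j 0, comp_zero]
    exact congrArg Rep.Hom.hom (sub_eq_zero.1 this).symm

lemma nontrivial_end_of_indecomposable {V : Rep.{w} O G} (hV : Indecomposable V) :
    Nontrivial (IntertwiningMap V.ρ V.ρ) := by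
  refine ⟨1, 0, fun h => hV.1 ((IsZero.iff_id_eq_zero V).2 (Rep.hom_ext h))⟩

/-- Induction over direct sum decompositions of a finitely generated representation. -/
theorem induction_of_indecomposable [IsNoetherianRing O] {motive : Rep.{w} O G → Prop}
    (L : Rep.{w} O G) [Module.Finite O L] (zero : ∀ W, IsZero W → motive W)
    (indecomposable : ∀ W, Indecomposable W → Nonempty (Retract W L) → motive W)
    (add : ∀ W Y Z : Rep.{w} O G, (W ≅ Y ⊞ Z) → motive Y → motive Z → motive W) :
    motive L := by
  -- Noetherian induction on the kernel of the retraction `L → W`, which grows strictly when `W` is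
  -- replaced by a summand with nonzero complement.
  suffices h : ∀ (N : Submodule O L) (W : Rep.{w} O G) (h : Retract W L),
      LinearMap.ker h.r.hom.toLinearMap = N → motive W from h _ L (Retract.refl L) rfl
  intro N
  induction N using WellFoundedGT.induction with
  | ind N ih =>
    rintro W h rfl
    by_cases h₀ : IsZero W
    · exact zero W h₀
    by_cases hW : Indecomposable W
    · exact indecomposable W hW ⟨h⟩
    obtain ⟨Y, Z, φ, hY, hZ⟩ : ∃ Y Z : Rep.{w} O G, ∃ _ : W ≅ Y ⊞ Z, ¬ IsZero Y ∧ ¬ IsZero Z := by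
      by_contra! hc
      refine hW ⟨h₀, fun Y Z φ => ?_⟩
      by_contra! hc'
      exact hc'.2 (hc Y Z φ hc'.1)
    have key : ∀ (A B : Rep.{w} O G) (i : A ⟶ W) (r : W ⟶ A) (j : B ⟶ W) (s : W ⟶ B),
        i ≫ r = 𝟙 A → j ≫ s = 𝟙 B → j ≫ r = 0 → ¬ IsZero B → motive A := by
      intro A B i r j s hir hjs hjr hB
      refine ih _ ?_ A ((Retract.mk i r hir).trans h) rfl
      refine lt_of_le_of_ne (fun x hx => ?_) fun heq => hB ?_
      · change r.hom (h.r.hom x) = 0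
        rw [show h.r.hom x = 0 from hx, map_zero]
      · rw [IsZero.iff_id_eq_zero, ← hjs]
        suffices hj : j = 0 by rw [hj, zero_comp]
        ext x
        have hx : h.i.hom (j.hom x) ∈ LinearMap.ker (h.r ≫ r).hom.toLinearMap := by
          change r.hom (h.r.hom (h.i.hom (j.hom x))) = 0
          rw [show h.r.hom (h.i.hom (j.hom x)) = j.hom x from
            congrArg (fun f : W ⟶ W => f.hom (j.hom x)) h.retract]
          exact congrArg (fun f : B ⟶ A => f.hom x) hjr
        rw [show LinearMap.ker (h.r ≫ r).hom.toLinearMap = LinearMap.ker h.r.hom.toLinearMap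
          from heq.symm] at hx
        have hx' : h.r.hom (h.i.hom (j.hom x)) = 0 := hx
        rwa [show h.r.hom (h.i.hom (j.hom x)) = j.hom x from
            congrArg (fun f : W ⟶ W => f.hom (j.hom x)) h.retract] at hx'
    refine add W Y Z φ
      (key Y Z (biprod.inl ≫ φ.inv) (φ.hom ≫ biprod.fst) (biprod.inr ≫ φ.inv)
        (φ.hom ≫ biprod.snd) (by simp) (by simp) (by simp) hZ)
      (key Z Y (biprod.inr ≫ φ.inv) (φ.hom ≫ biprod.snd) (biprod.inl ≫ φ.inv)
        (φ.hom ≫ biprod.fst) (by simp) (by simp) (by simp) hY)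

end Indecomposable

open Representation IsLocalRing

/-! ### Endomorphisms of capped indecomposable modules -/

section Capped

variable {O : Type u} [CommRing O] [IsLocalRing O] {G : Type v} [Group G]

lemma isLocalRing_end_of_indecomposable [IsNoetherianRing O]
    [IsAdicComplete (maximalIdeal O) O] {V : Rep.{w} O G} [Module.Finite O V]
    (hV : Indecomposable V) : IsLocalRing (IntertwiningMap V.ρ V.ρ) := by
  have := nontrivial_end_of_indecomposable hV
  have : IsNoetherian O V := isNoetherian_of_isNoetherianRing_of_finite O V
  exact isLocalRing_of_forall_idempotent (O := O) (eq_zero_or_one_of_indecomposable hV)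

variable [Finite G]

lemma one_mem_negligible_of_not_isCapped {V : Rep.{w} O G} (hV : ¬ IsCapped V) :
    (1 : IntertwiningMap V.ρ V.ρ) ∈ negligible V.ρ V.ρ := by
  obtain ⟨Q, hQ, hQ'⟩ : ∃ Q, IsRelProjective V Q ∧ Q ≠ ⊤ := by
    by_contra! h
    exact hV ⟨isRelProjective_top V, fun Q hQ _ => (h Q hQ).ge⟩
  exact id_mem_brauerNull_of_isRelProjective V (lt_top_iff_ne_top.2 hQ') hQ

/-- The nonunits of a local endomorphism ring form a submodule. -/
def nonunitsSubmodule {E : Type*} [Ring E] [Algebra O E] [IsLocalRing E]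
    (hE : ∀ e : E, e * e = e → e = 0 ∨ e = 1) : Submodule O E where
  carrier := nonunits E
  add_mem' := IsLocalRing.nonunits_add
  zero_mem' := by simp
  smul_mem' c x hx := by
    have := mul_mul_mem_nonunits hE hx (algebraMap O E c) 1
    rwa [mul_one, ← Algebra.smul_def] at this

/-- If a trace from `Q < ⊤` had an inverse `y`, absorbing `y` into the trace would express the
identity as a trace from `Q`, contradicting the vertex `⊤`. The part in `𝔪` is handled by Nakayama.
-/
lemma negligible_le_nonunitsSubmodule [IsNoetherianRing O] {V : Rep.{w} O G} [Module.Finite O V]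
    [IsLocalRing (IntertwiningMap V.ρ V.ρ)]
    (hE : ∀ e : IntertwiningMap V.ρ V.ρ, e * e = e → e = 0 ∨ e = 1) (hV : IsCapped V) :
    negligible V.ρ V.ρ ≤ nonunitsSubmodule (O := O) hE := by
  rw [← Submodule.map_le_map_iff_of_injective
    (f := IntertwiningMap.toLinearMapl V.ρ V.ρ) (IntertwiningMap.toLinearMap_injective V.ρ V.ρ),
    map_toLinearMapl_negligible]
  refine brauerNull_le (fun Q hQ m => ?_) fun a ha x hx => ?_
  · let t : IntertwiningMap V.ρ V.ρ := invariantsEquivIntertwiningMap _ _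
      (relTrace (V.ρ.linHom V.ρ) Q m)
    refine ⟨t, fun ht => ?_, rfl⟩
    obtain ⟨y, hy⟩ := ht.exists_right_inv
    refine hQ.not_ge (hV.2 (isRelProjective_of_relTrace_eq_id V Q
      ⟨_, map_mem_fixedPoints (linHom_lcomp y) m.2⟩ ?_) le_top)
    rw [← map_relTrace (linHom_lcomp y)]
    exact congrArg IntertwiningMap.toLinearMap hy
  · let t : IntertwiningMap V.ρ V.ρ := invariantsEquivIntertwiningMap _ _ ⟨x, hx⟩
    exact ⟨a • t, maximalIdeal_smul_mem_nonunits (O := O) (Submodule.smul_mem_smul ha trivial),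
      rfl⟩

variable [IsNoetherianRing O] [IsAdicComplete (maximalIdeal O) O]

lemma one_notMem_negligible {V : Rep.{w} O G} [Module.Finite O V]
    (hV : Indecomposable V) (hV' : IsCapped V) :
    (1 : IntertwiningMap V.ρ V.ρ) ∉ negligible V.ρ V.ρ := fun h => by
  have := isLocalRing_end_of_indecomposable hV
  exact negligible_le_nonunitsSubmodule (eq_zero_or_one_of_indecomposable hV) hV' h isUnit_one

/-- Choose `c` with `a - c` a nonunit. Were it not negligible, simplicity would put `1` in the ideal
it generates plus negligible maps, all of which are nonunits. -/
lemma exists_sub_smul_one_mem_negligible [IsDomain O] [IsPrincipalIdealRing O]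
    [IsAlgClosed (ResidueField O)] {V : Rep.{w} O G}
    [Module.Finite O V] (hV : Indecomposable V) (hV' : IsCapped V) (hend : IsEndopermutation V)
    (a : IntertwiningMap V.ρ V.ρ) : ∃ c : O, a - c • 1 ∈ negligible V.ρ V.ρ := by
  have := isLocalRing_end_of_indecomposable hV
  have : IsNoetherian O V := isNoetherian_of_isNoetherianRing_of_finite O V
  have hE := eq_zero_or_one_of_indecomposable hV
  obtain ⟨ι, b, hb⟩ := hend
  have : Module.Free O (V →ₗ[O] V) := Module.Free.of_basis b
  have : Module.Free O V := free_of_free_end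
  obtain ⟨c, hc⟩ := exists_sub_algebraMap_mem_nonunits (O := O) a
  refine ⟨c, by_contra fun h => ?_⟩
  rw [← IntertwiningMap.algebraMap_apply] at h
  have h₁ := mem_span_mul_mul_sup_negligible b hb h 1
  have h₂ : Submodule.span O {z | ∃ x y : IntertwiningMap V.ρ V.ρ,
      z = x * (a - algebraMap O _ c) * y} ⊔ negligible V.ρ V.ρ ≤ nonunitsSubmodule (O := O) hE := by
    refine sup_le (Submodule.span_le.2 ?_) (negligible_le_nonunitsSubmodule hE hV')
    rintro _ ⟨x, y, rfl⟩
    exact mul_mul_mem_nonunits hE hc x y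
  exact h₂ h₁ isUnit_one

/-- The projection of `V ⊕ W` onto `V` is not negligible because `id_V` is not, so by simplicity it
generates the identity of `V ⊕ W`; cutting down to `W` leaves maps through `V`. -/
lemma one_mem_factorsThrough_sup_negligible [IsDomain O] [IsPrincipalIdealRing O]
    {V W : Rep.{w} O G} [Module.Finite O V] [Module.Finite O W] (hV : Indecomposable V)
    (hV' : IsCapped V) (hVW : AreCompatibleEndopermutation V W) :
    (1 : IntertwiningMap W.ρ W.ρ) ∈ factorsThrough V.ρ W.ρ ⊔ negligible W.ρ W.ρ := by
  obtain ⟨-, -, ι, b, hb⟩ := hVW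
  have : Module.Free O (V × W →ₗ[O] V × W) := Module.Free.of_basis b
  have : Module.Free O (V × W) := free_of_free_end
  let inl := IntertwiningMap.inl O V.ρ W.ρ
  let inr := IntertwiningMap.inr O V.ρ W.ρ
  let fst := IntertwiningMap.fst O V.ρ W.ρ
  let snd := IntertwiningMap.snd O V.ρ W.ρ
  have h : inl.comp fst ∉ negligible (V.ρ.prod W.ρ) (V.ρ.prod W.ρ) := fun h =>
    one_notMem_negligible hV hV' (comp_mem_negligible fst (mem_negligible_comp h inl))
  have h₁ := mem_span_mul_mul_sup_negligible b hb h 1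
  obtain ⟨x, hx, n, hn, hxn⟩ := Submodule.mem_sup.1 h₁
  have h₂ : (1 : IntertwiningMap W.ρ W.ρ) = snd.comp ((x + n).comp inr) := by
    rw [hxn]
    rfl
  rw [h₂, IntertwiningMap.comp_add, IntertwiningMap.add_comp]
  refine add_mem (Submodule.mem_sup_left ?_)
    (Submodule.mem_sup_right (comp_mem_negligible snd (mem_negligible_comp hn inr)))
  clear h₁ hxn h₂
  induction hx using Submodule.span_induction with
  | mem x hx =>
    obtain ⟨f, g, rfl⟩ := hx
    exact Submodule.subset_span ⟨snd.comp (f.comp inl), fst.comp (g.comp inr), rfl⟩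
  | zero =>
    convert Submodule.zero_mem _
    ext1
    simp
  | add x y _ _ hx hy =>
    rw [IntertwiningMap.comp_add, IntertwiningMap.add_comp]
    exact add_mem hx hy
  | smul c x _ hx =>
    rw [IntertwiningMap.smul_comp, IntertwiningMap.comp_smul]
    exact Submodule.smul_mem _ _ hx

end Capped

/-! ### One module generating all objects modulo negligible maps -/

section Decomposition

open Limits

variable {O : Type u} [CommRing O] {G : Type v} [Group G]

lemma moduleFinite_of_retract {V L : Rep.{w} O G} [Module.Finite O L] (h : Retract V L) :
    Module.Finite O V :=
  Module.Finite.of_surjective h.r.hom.toLinearMap fun x =>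
    ⟨h.i.hom x, congrArg (fun f : V ⟶ V => f.hom x) h.retract⟩

variable [IsLocalRing O] [Finite G]

lemma factors_of_indecomposable_factors [IsNoetherianRing O] {V L : Rep.{w} O G}
    [Module.Finite O L]
    (h : ∀ W, Indecomposable W → Nonempty (Retract W L) →
      (1 : IntertwiningMap W.ρ W.ρ) ∈ factorsThrough V.ρ W.ρ ⊔ negligible W.ρ W.ρ) :
    (1 : IntertwiningMap L.ρ L.ρ) ∈ factorsThrough V.ρ L.ρ ⊔ negligible L.ρ L.ρ := by
  refine induction_of_indecomposable (motive := fun W => (1 : IntertwiningMap W.ρ W.ρ) ∈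
    factorsThrough V.ρ W.ρ ⊔ negligible W.ρ W.ρ) L (fun W hW => ?_) h fun W Y Z φ hY hZ => ?_
  · have : (1 : IntertwiningMap W.ρ W.ρ) = 0 :=
      congrArg Rep.Hom.hom ((IsZero.iff_id_eq_zero W).1 hW)
    rw [this]
    exact zero_mem _
  · have h₁ := comp_comp_mem_factorsThrough_sup_negligible hY (biprod.inl ≫ φ.inv).hom
      (φ.hom ≫ biprod.fst).hom
    have h₂ := comp_comp_mem_factorsThrough_sup_negligible hZ (biprod.inr ≫ φ.inv).hom
      (φ.hom ≫ biprod.snd).hom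
    have h₃ : 𝟙 W = ((φ.hom ≫ biprod.fst) ≫ 𝟙 Y) ≫ biprod.inl ≫ φ.inv +
        ((φ.hom ≫ biprod.snd) ≫ 𝟙 Z) ≫ biprod.inr ≫ φ.inv := by
      simp only [Category.comp_id, Category.assoc]
      rw [← Preadditive.comp_add, ← Category.assoc, ← Category.assoc biprod.snd,
        ← Preadditive.add_comp, biprod.total, Category.id_comp, Iso.hom_inv_id]
    have h₄ := congrArg Rep.Hom.hom h₃
    change (1 : IntertwiningMap W.ρ W.ρ) = _ at h₄
    rw [h₄]
    exact add_mem h₁ h₂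

/-- There is a representation `V` whose endomorphisms are scalar modulo negligible ones, and such
that each object of `𝓜` is a direct sum of copies of `V` modulo negligible maps. -/
theorem exists_generator [IsDomain O] [IsPrincipalIdealRing O]
    [IsAdicComplete (maximalIdeal O) O] [IsAlgClosed (ResidueField O)]
    (𝓜 : ObjectProperty (Rep.{w} O G)) (hfg : ∀ M : Rep.{w} O G, 𝓜 M → Module.Finite O M)
    (hM : ∀ V W : Rep.{w} O G, IsCappedIndecomposableSummand 𝓜 V →
      IsCappedIndecomposableSummand 𝓜 W → AreCompatibleEndopermutation V W) :
    ∃ V : Rep.{w} O G, (∀ a : IntertwiningMap V.ρ V.ρ, ∃ c : O, a - c • 1 ∈ negligible V.ρ V.ρ) ∧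
      ∀ L, 𝓜 L → (1 : IntertwiningMap L.ρ L.ρ) ∈ factorsThrough V.ρ L.ρ ⊔ negligible L.ρ L.ρ := by
  have hfin : ∀ V, IsCappedIndecomposableSummand 𝓜 V → Module.Finite O V := by
    rintro V ⟨-, -, L, hL, ⟨h⟩⟩
    have := hfg L hL
    exact moduleFinite_of_retract h
  by_cases hV : ∃ V, IsCappedIndecomposableSummand 𝓜 V
  · obtain ⟨V, hV⟩ := hV
    have := hfin V hV
    refine ⟨V, exists_sub_smul_one_mem_negligible hV.1 hV.2.1 (hM V V hV hV).1, fun L hL => ?_⟩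
    have := hfg L hL
    refine factors_of_indecomposable_factors fun W hW ⟨h⟩ => ?_
    by_cases hc : IsCapped W
    · have hW' : IsCappedIndecomposableSummand 𝓜 W := ⟨hW, hc, L, hL, ⟨h⟩⟩
      have := hfin W hW'
      exact one_mem_factorsThrough_sup_negligible hV.1 hV.2.1 (hM V W hV hW')
    · exact Submodule.mem_sup_right (one_mem_negligible_of_not_isCapped hc)
  -- Without capped summands every identity is negligible, and the zero module serves as generator.
  · refine ⟨Rep.trivial O G PUnit.{w + 1}, fun a => ⟨0, ?_⟩, fun L hL => ?_⟩
    · rw [show a - (0 : O) • 1 = 0 from IntertwiningMap.ext (LinearMap.ext fun x => rfl)]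
      exact zero_mem _
    · have := hfg L hL
      refine factors_of_indecomposable_factors fun W hW h => ?_
      exact Submodule.mem_sup_right (one_mem_negligible_of_not_isCapped fun hc =>
        hV ⟨W, hW, hc, L, hL, h⟩)

end Decomposition

open Representation IsLocalRing

/-! ### The functor `Br(Hom_O(V, -))` and its full faithfulness modulo negligible maps -/

section BrauerHom

variable {O : Type*} [CommRing O] {G : Type*} [Group G]

variable {V W U T : Type*} [AddCommGroup V] [Module O V] [AddCommGroup W] [Module O W]
  [AddCommGroup U] [Module O U] [AddCommGroup T] [Module O T]
  {ρ : Representation O G V} {σ : Representation O G W}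
  {τ : Representation O G U} {υ : Representation O G T}

lemma zero_intertwiningMap_comp (f : IntertwiningMap ρ σ) :
    (0 : IntertwiningMap σ τ).comp f = 0 := by
  ext1
  simp

variable [IsLocalRing O] [Finite G]

instance (ρ : Representation O G V) :
    IsScalarTower O (ResidueField O) (BrauerQuotient ρ) :=
  IsScalarTower.of_algebraMap_smul fun a x => residue_smul_brauerQuotient ρ a x

variable (ρ σ) in
/-- The Brauer map on intertwining maps. -/
def brauerHom : IntertwiningMap ρ σ →ₗ[O] BrauerQuotient (ρ.linHom σ) :=
  brauerMap (ρ.linHom σ) ∘ₗ (invariantsEquivIntertwiningMap ρ σ).symm.toLinearMap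

lemma brauerHom_surjective : Function.Surjective (brauerHom ρ σ) :=
  (Submodule.mkQ_surjective _).comp (invariantsEquivIntertwiningMap ρ σ).symm.surjective

lemma brauerHom_eq_zero_iff {f : IntertwiningMap ρ σ} :
    brauerHom ρ σ f = 0 ↔ f ∈ negligible ρ σ :=
  (Submodule.Quotient.mk_eq_zero _).trans coe_mem_brauerNull.symm

lemma ker_brauerHom : LinearMap.ker (brauerHom ρ σ) = negligible ρ σ := by
  ext f
  exact brauerHom_eq_zero_iff

variable (ρ) in
/-- The map `Br(Hom_O(V, W)) → Br(Hom_O(V, U))` induced by an intertwining map `W → U`. -/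
def postcomp (u : IntertwiningMap σ τ) : BrauerQuotient (ρ.linHom σ) →ₗ[ResidueField O]
    BrauerQuotient (ρ.linHom τ) :=
  LinearMap.extendScalarsOfSurjective residue_surjective <|
    (brauerKernel (ρ.linHom σ)).liftQ
      (brauerHom ρ τ ∘ₗ IntertwiningMap.llcomp ρ σ τ u ∘ₗ
        (invariantsEquivIntertwiningMap ρ σ).toLinearMap) fun _ hx =>
      brauerHom_eq_zero_iff.2 (comp_mem_negligible u (coe_mem_brauerNull.2 hx))

lemma postcomp_brauerHom (u : IntertwiningMap σ τ) (f : IntertwiningMap ρ σ) :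
    postcomp ρ u (brauerHom ρ σ f) = brauerHom ρ τ (u.comp f) := rfl

lemma brauerQuotient_linearMap_ext {X : Type*} [AddCommGroup X] [Module (ResidueField O) X]
    {φ ψ : BrauerQuotient (ρ.linHom σ) →ₗ[ResidueField O] X}
    (h : ∀ f, φ (brauerHom ρ σ f) = ψ (brauerHom ρ σ f)) : φ = ψ := by
  refine LinearMap.ext fun x => ?_
  obtain ⟨f, rfl⟩ := brauerHom_surjective x
  exact h f

lemma postcomp_id : postcomp ρ (IntertwiningMap.id σ) = LinearMap.id :=
  brauerQuotient_linearMap_ext fun _ => rfl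

lemma postcomp_comp (u : IntertwiningMap σ τ) (v : IntertwiningMap τ υ) :
    postcomp ρ (v.comp u) = postcomp ρ v ∘ₗ postcomp ρ u :=
  brauerQuotient_linearMap_ext fun _ => rfl

variable (ρ σ τ) in
/-- Postcomposition as a linear map. -/
def postcompLinear : IntertwiningMap σ τ →ₗ[O]
    BrauerQuotient (ρ.linHom σ) →ₗ[ResidueField O] BrauerQuotient (ρ.linHom τ) where
  toFun := postcomp ρ
  map_add' u v := brauerQuotient_linearMap_ext fun f => by
    rw [LinearMap.add_apply, postcomp_brauerHom, postcomp_brauerHom, postcomp_brauerHom,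
      IntertwiningMap.comp_add, map_add]
  map_smul' c u := brauerQuotient_linearMap_ext fun f => by
    rw [RingHom.id_apply, LinearMap.smul_apply, postcomp_brauerHom, postcomp_brauerHom,
      IntertwiningMap.smul_comp, map_smul]

/-- If `u` induces zero, then `u ∘ f` is negligible for all `f : ρ → σ`, hence so is `u ∘ f ∘ g`;
such `f ∘ g` span the identity of `σ` modulo negligible maps. -/
lemma ker_postcompLinear
    (hσ : (1 : IntertwiningMap σ σ) ∈ factorsThrough ρ σ ⊔ negligible σ σ) :
    LinearMap.ker (postcompLinear ρ σ τ) = negligible σ τ := by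
  ext u
  rw [LinearMap.mem_ker]
  constructor
  · intro hu
    obtain ⟨x, hx, n, hn, hxn⟩ := Submodule.mem_sup.1 hσ
    have h : u = u.comp (x + n) := by
      rw [hxn]
      rfl
    rw [h, IntertwiningMap.add_comp]
    refine add_mem ?_ (comp_mem_negligible u hn)
    clear h hxn
    induction hx using Submodule.span_induction with
    | mem x hx =>
      obtain ⟨f, g, rfl⟩ := hx
      have huf : u.comp f ∈ negligible ρ τ := by
        rw [← brauerHom_eq_zero_iff, ← postcomp_brauerHom]
        exact LinearMap.congr_fun hu _
      exact mem_negligible_comp huf g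
    | zero =>
      convert Submodule.zero_mem _
      ext1
      simp
    | add x y _ _ hx hy =>
      rw [IntertwiningMap.add_comp]
      exact add_mem hx hy
    | smul c x _ hx =>
      rw [IntertwiningMap.comp_smul]
      exact Submodule.smul_mem _ _ hx
  · intro hu
    refine brauerQuotient_linearMap_ext fun f => ?_
    exact brauerHom_eq_zero_iff.2 (mem_negligible_comp hu f)

lemma brauerHom_comp_of_sub_smul_one_mem {a : IntertwiningMap ρ ρ} {c : O}
    (h : a - c • 1 ∈ negligible ρ ρ) (f : IntertwiningMap ρ σ) :
    brauerHom ρ σ (f.comp a) = c • brauerHom ρ σ f := by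
  rw [← sub_add_cancel a (c • 1), IntertwiningMap.add_comp, map_add,
    brauerHom_eq_zero_iff.2 (comp_mem_negligible f h), zero_add,
    IntertwiningMap.comp_smul, map_smul]
  rfl

lemma postcompLinear_surjective
    (hρ : ∀ a : IntertwiningMap ρ ρ, ∃ c : O, a - c • 1 ∈ negligible ρ ρ)
    (hσ : (1 : IntertwiningMap σ σ) ∈ factorsThrough ρ σ ⊔ negligible σ σ) :
    Function.Surjective (postcompLinear ρ σ τ) := by
  intro φ
  have key : ∀ x ∈ factorsThrough ρ σ, ∃ u : IntertwiningMap σ τ, ∀ h : IntertwiningMap ρ σ,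
      brauerHom ρ τ (u.comp h) = φ (brauerHom ρ σ (x.comp h)) := by
    intro x hx
    induction hx using Submodule.span_induction with
    | mem x hx =>
      obtain ⟨f, g, rfl⟩ := hx
      obtain ⟨m, hm⟩ := brauerHom_surjective (φ (brauerHom ρ σ f))
      -- Since `g ∘ h` is a scalar `c` modulo negligible maps, `m ∘ g ∘ h` and `φ(f ∘ g ∘ h)` both
      -- reduce to `c • φ(f)`.
      refine ⟨m.comp g, fun h => ?_⟩
      obtain ⟨c, hc⟩ := hρ (g.comp h)
      have hφ : ∀ (c : O) (x : BrauerQuotient (ρ.linHom σ)), φ (c • x) = c • φ x := fun c x => by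
        rw [← residue_smul_brauerQuotient, map_smul, residue_smul_brauerQuotient]
      calc brauerHom ρ τ (m.comp (g.comp h)) = c • brauerHom ρ τ m :=
          brauerHom_comp_of_sub_smul_one_mem hc m
        _ = φ (c • brauerHom ρ σ f) := by rw [hm, hφ]
        _ = φ (brauerHom ρ σ (f.comp (g.comp h))) := by
          rw [brauerHom_comp_of_sub_smul_one_mem hc f]
    | zero =>
      refine ⟨0, fun h => ?_⟩
      rw [zero_intertwiningMap_comp, zero_intertwiningMap_comp, map_zero, map_zero, map_zero]
    | add x y _ _ hx hy =>
      obtain ⟨u, hu⟩ := hx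
      obtain ⟨v, hv⟩ := hy
      refine ⟨u + v, fun h => ?_⟩
      rw [IntertwiningMap.comp_add, IntertwiningMap.comp_add, map_add, map_add, map_add, hu, hv]
    | smul c x _ hx =>
      obtain ⟨u, hu⟩ := hx
      refine ⟨c • u, fun h => ?_⟩
      rw [IntertwiningMap.smul_comp, IntertwiningMap.smul_comp, map_smul, map_smul, hu,
        ← residue_smul_brauerQuotient, ← residue_smul_brauerQuotient, map_smul]
  obtain ⟨x, hx, n, hn, hxn⟩ := Submodule.mem_sup.1 hσ
  obtain ⟨u, hu⟩ := key x hx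
  refine ⟨u, brauerQuotient_linearMap_ext fun h => ?_⟩
  have hh : h = (x + n).comp h := by
    rw [hxn]
    rfl
  refine (hu h).trans ?_
  conv_rhs => rw [hh, IntertwiningMap.comp_add, map_add,
    brauerHom_eq_zero_iff.2 (mem_negligible_comp hn h), add_zero]

/-- The isomorphism between a Brauer quotient and the linear maps between the values of the slash
functor. -/
def postcompEquiv (hρ : ∀ a : IntertwiningMap ρ ρ, ∃ c : O, a - c • 1 ∈ negligible ρ ρ)
    (hσ : (1 : IntertwiningMap σ σ) ∈ factorsThrough ρ σ ⊔ negligible σ σ) :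
    BrauerQuotient (σ.linHom τ) ≃ₗ[ResidueField O]
      (BrauerQuotient (ρ.linHom σ) →ₗ[ResidueField O] BrauerQuotient (ρ.linHom τ)) :=
  LinearEquiv.extendScalarsOfSurjective (S := ResidueField O) residue_surjective <|
    -- Both sides are quotients of the space of intertwining maps by the negligible ones.
    (LinearMap.quotKerEquivOfSurjective (brauerHom σ τ) brauerHom_surjective).symm ≪≫ₗ
      Submodule.quotEquivOfEq _ _ (ker_brauerHom.trans (ker_postcompLinear hσ).symm) ≪≫ₗ
      LinearMap.quotKerEquivOfSurjective (postcompLinear ρ σ τ) (postcompLinear_surjective hρ hσ)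

lemma postcompEquiv_brauerHom
    (hρ : ∀ a : IntertwiningMap ρ ρ, ∃ c : O, a - c • 1 ∈ negligible ρ ρ)
    (hσ : (1 : IntertwiningMap σ σ) ∈ factorsThrough ρ σ ⊔ negligible σ σ)
    (u : IntertwiningMap σ τ) :
    postcompEquiv (τ := τ) hρ hσ (brauerHom σ τ u) = postcomp ρ u := by
  have h : (LinearMap.quotKerEquivOfSurjective (brauerHom σ τ) brauerHom_surjective).symm
      (brauerHom σ τ u) = (LinearMap.ker (brauerHom σ τ)).mkQ u := by
    rw [LinearEquiv.symm_apply_eq]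
    rfl
  change LinearMap.quotKerEquivOfSurjective (postcompLinear ρ σ τ)
    (postcompLinear_surjective hρ hσ)
    (Submodule.quotEquivOfEq _ _ (ker_brauerHom.trans (ker_postcompLinear hσ).symm)
      ((LinearMap.quotKerEquivOfSurjective (brauerHom σ τ) brauerHom_surjective).symm
        (brauerHom σ τ u))) = _
  rw [h]
  rfl

end BrauerHom

section Functor

variable {O : Type u} [CommRing O] [IsLocalRing O] {G : Type v} [Group G] [Finite G]

/-- The functor `M ↦ Br(Hom_O(V, M))`. -/
def brauerHomFunctor (V : Rep.{w} O G) (𝓜 : ObjectProperty (Rep.{w} O G)) :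
    𝓜.FullSubcategory ⥤ ModuleCat.{w} (ResidueField O) where
  obj M := ModuleCat.of _ (BrauerQuotient (V.ρ.linHom M.obj.ρ))
  map u := ModuleCat.ofHom (postcomp V.ρ u.hom.hom)
  map_id _ := ModuleCat.hom_ext postcomp_id
  map_comp u v := ModuleCat.hom_ext (postcomp_comp u.hom.hom v.hom.hom)

lemma isSlashFunctor_brauerHomFunctor {V : Rep.{w} O G} {𝓜 : ObjectProperty (Rep.{w} O G)}
    (hV : ∀ a : IntertwiningMap V.ρ V.ρ, ∃ c : O, a - c • 1 ∈ negligible V.ρ V.ρ)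
    (h : ∀ L, 𝓜 L → (1 : IntertwiningMap L.ρ L.ρ) ∈ factorsThrough V.ρ L.ρ ⊔ negligible L.ρ L.ρ) :
    IsSlashFunctor (brauerHomFunctor V 𝓜) := fun L _ =>
  ⟨postcompEquiv hV (h L.obj L.property), fun u =>
    (postcompEquiv_brauerHom hV (h L.obj L.property) u.hom.hom).symm⟩

end Functor

open IsLocalRing

/-! ### Uniqueness of slash functors -/

section Uniqueness

variable {O : Type u} [CommRing O] [IsLocalRing O] {G : Type v} [Group G] [Finite G]
  {𝓜 : ObjectProperty (Rep.{w} O G)}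
  {Sl Sl' : 𝓜.FullSubcategory ⥤ ModuleCat.{w} (ResidueField O)}

/-- Two slash functors identify the spaces of linear maps between their values. -/
lemma exists_linearEquiv_map (h : IsSlashFunctor Sl) (h' : IsSlashFunctor Sl')
    (L M : 𝓜.FullSubcategory) :
    ∃ φ : (Sl.obj L →ₗ[ResidueField O] Sl.obj M) ≃ₗ[ResidueField O]
      (Sl'.obj L →ₗ[ResidueField O] Sl'.obj M),
      ∀ u : L ⟶ M, φ (Sl.map u).hom = (Sl'.map u).hom := by
  obtain ⟨e, he⟩ := h L M
  obtain ⟨e', he'⟩ := h' L M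
  exact ⟨e.symm ≪≫ₗ e', fun u => by rw [he, he']; simp⟩

lemma map_hom_surjective (h : IsSlashFunctor Sl) (L M : 𝓜.FullSubcategory)
    (A : Sl.obj L →ₗ[ResidueField O] Sl.obj M) : ∃ u : L ⟶ M, (Sl.map u).hom = A := by
  obtain ⟨e, he⟩ := h L M
  obtain ⟨x, hx⟩ := Submodule.mkQ_surjective _ (e.symm A)
  refine ⟨ObjectProperty.homMk
    (Representation.linHom.invariantsEquivRepHom L.obj M.obj x), ?_⟩
  rw [he]
  change e ((brauerKernel _).mkQ x) = A
  rw [hx, e.apply_symm_apply]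

lemma nontrivial_of_nontrivial (h : IsSlashFunctor Sl) (h' : IsSlashFunctor Sl')
    {L : 𝓜.FullSubcategory} [Nontrivial (Sl.obj L)] : Nontrivial (Sl'.obj L) := by
  obtain ⟨φ, -⟩ := exists_linearEquiv_map h h' L L
  by_contra hn
  rw [not_nontrivial_iff_subsingleton] at hn
  have : (LinearMap.id : Sl.obj L →ₗ[ResidueField O] Sl.obj L) = 0 :=
    φ.injective (Subsingleton.elim _ _)
  obtain ⟨x, hx⟩ := exists_ne (0 : Sl.obj L)
  exact hx (LinearMap.congr_fun this x)

theorem nonempty_iso_of_isSlashFunctor (h : IsSlashFunctor Sl) (h' : IsSlashFunctor Sl') :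
    Nonempty (Sl ≅ Sl') := by
  by_cases hL : ∃ L, Nontrivial (Sl.obj L)
  · obtain ⟨L, hL⟩ := hL
    choose φ hφ using exists_linearEquiv_map h h'
    -- Every linear map is some `Sl.map u`, so functoriality makes the identifications `φ`
    -- multiplicative.
    have hcomp : ∀ {L M N} (A : Sl.obj M →ₗ[ResidueField O] Sl.obj N)
        (B : Sl.obj L →ₗ[ResidueField O] Sl.obj M), φ L N (A ∘ₗ B) = φ M N A ∘ₗ φ L M B := by
      intro L M N A B
      obtain ⟨u, rfl⟩ := map_hom_surjective h _ _ A
      obtain ⟨v, rfl⟩ := map_hom_surjective h _ _ B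
      rw [hφ, hφ, ← ModuleCat.hom_comp, ← ModuleCat.hom_comp, ← Functor.map_comp,
        ← Functor.map_comp, hφ]
    obtain ⟨x₀, hx₀⟩ := exists_ne (0 : Sl.obj L)
    obtain ⟨f, hf⟩ := Module.Projective.exists_dual_eq_one (ResidueField O) hx₀
    have he : φ L L (f.smulRight x₀) ≠ 0 := fun h => by
      have := (map_eq_zero_iff _ (φ L L).injective).1 h
      have := LinearMap.congr_fun this x₀
      rw [LinearMap.smulRight_apply, hf, one_smul] at this
      exact hx₀ this
    obtain ⟨y, hy⟩ : ∃ y, φ L L (f.smulRight x₀) y ≠ 0 := by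
      by_contra! hc
      exact he (LinearMap.ext hc)
    -- A vector `v` is encoded by the rank-one map `f.smulRight v`, transported by `φ` and evaluated
    -- at `y`; the choice of `y` ensures `ξ L x₀ ≠ 0`.
    let ξ : ∀ M, Sl.obj M →ₗ[ResidueField O] Sl'.obj M := fun M =>
      { toFun := fun v => φ L M (f.smulRight v) y
        map_add' := fun v w => by
          rw [← LinearMap.add_apply, ← map_add]
          congr 2
          ext z
          simp
        map_smul' := fun c v => by
          rw [RingHom.id_apply, ← LinearMap.smul_apply, ← map_smul]
          congr 2
          ext z
          simp [smul_comm c] }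
    have hξ : ∀ {M N} (A : Sl.obj M →ₗ[ResidueField O] Sl.obj N) (v : Sl.obj M),
        ξ N (A v) = φ M N A (ξ M v) := fun {M N} A v => by
      change φ L N (f.smulRight (A v)) y = φ M N A (φ L M (f.smulRight v) y)
      rw [← LinearMap.comp_apply, ← hcomp]
      congr 2
      ext z
      simp
    have hinj : ∀ M, Function.Injective (ξ M) := fun M => by
      rw [← LinearMap.ker_eq_bot, LinearMap.ker_eq_bot']
      intro v hv
      by_contra hv₀
      obtain ⟨g, hg⟩ := Module.Projective.exists_dual_eq_one (ResidueField O) hv₀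
      have := hξ (g.smulRight x₀) v
      rw [hv, map_zero, LinearMap.smulRight_apply, hg, one_smul] at this
      exact hy this
    have hsurj : ∀ M, Function.Surjective (ξ M) := fun M z => by
      obtain ⟨g, hg⟩ := Module.Projective.exists_dual_eq_one (ResidueField O) (show ξ L x₀ ≠ 0 from hy)
      obtain ⟨A, hA⟩ := (φ L M).surjective (g.smulRight z)
      refine ⟨A x₀, ?_⟩
      rw [hξ, hA, LinearMap.smulRight_apply, hg, one_smul]
    refine ⟨NatIso.ofComponents
      (fun M => (LinearEquiv.ofBijective (ξ M) ⟨hinj M, hsurj M⟩).toModuleIso) fun {M N} u => ?_⟩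
    ext v
    change ξ N ((Sl.map u).hom v) = (Sl'.map u).hom (ξ M v)
    rw [hξ, hφ]
  · have hsub : ∀ M, Subsingleton (Sl.obj M) := fun M =>
      not_nontrivial_iff_subsingleton.1 fun hM => hL ⟨M, hM⟩
    have hsub' : ∀ M, Subsingleton (Sl'.obj M) := fun M =>
      not_nontrivial_iff_subsingleton.1 fun hM => hL ⟨M, nontrivial_of_nontrivial h' h⟩
    refine ⟨NatIso.ofComponents (fun M =>
      (LinearEquiv.ofBijective (0 : Sl.obj M →ₗ[ResidueField O] Sl'.obj M)
        ⟨fun _ _ _ => Subsingleton.elim _ _, fun z => ⟨0, Subsingleton.elim _ _⟩⟩).toModuleIso)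
      fun {M N} u => ?_⟩
    ext v
    exact Subsingleton.elim _ _

/-- By fullness the automorphism `ξ⁻¹ξ'` of `Sl` commutes with all linear maps. Testing on the
rank-one maps out of a single nonzero `Sl.obj L` gives the same scalar for every object. -/
theorem iso_unique_up_to_scalar (h : IsSlashFunctor Sl) (ξ ξ' : Sl ≅ Sl') :
    ∃ c : (ResidueField O)ˣ, ∀ M : 𝓜.FullSubcategory,
      ξ'.hom.app M = (c : ResidueField O) • ξ.hom.app M := by
  by_cases hL : ∃ L, Nontrivial (Sl.obj L)
  · obtain ⟨L, hL⟩ := hL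
    obtain ⟨x₀, hx₀⟩ := exists_ne (0 : Sl.obj L)
    obtain ⟨f, hf⟩ := Module.Projective.exists_dual_eq_one (ResidueField O) hx₀
    let θ := ξ' ≪≫ ξ.symm
    have hθ : ∀ {M N} (A : Sl.obj M →ₗ[ResidueField O] Sl.obj N) (v : Sl.obj M),
        (θ.hom.app N).hom (A v) = A ((θ.hom.app M).hom v) := fun {M N} A v => by
      obtain ⟨u, rfl⟩ := map_hom_surjective h _ _ A
      exact congrArg (fun g => g.hom v) (θ.hom.naturality u)
    let c : ResidueField O := f ((θ.hom.app L).hom x₀)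
    have hc : ∀ (M) (v : Sl.obj M), (θ.hom.app M).hom v = c • v := fun M v => by
      have := hθ (f.smulRight v) x₀
      rwa [LinearMap.smulRight_apply, LinearMap.smulRight_apply, hf, one_smul] at this
    have hc₀ : c ≠ 0 := fun hc₀ => hx₀ <| by
      have h₁ := hc L x₀
      rw [hc₀, zero_smul] at h₁
      have h₂ : (θ.inv.app L).hom ((θ.hom.app L).hom x₀) = x₀ :=
        congrArg (fun g => g.hom x₀) (θ.hom_inv_id_app L)
      rw [← h₂, h₁, map_zero]
    refine ⟨Units.mk0 c hc₀, fun M => ?_⟩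
    ext v
    have h₁ : (ξ.hom.app M).hom ((θ.hom.app M).hom v) = (ξ'.hom.app M).hom v := by
      have : θ.hom.app M ≫ ξ.hom.app M = ξ'.hom.app M := by simp [θ]
      exact congrArg (fun g => g.hom v) this
    rw [hc, map_smul] at h₁
    exact h₁.symm
  · refine ⟨1, fun M => ?_⟩
    have : Subsingleton (Sl.obj M) := not_nontrivial_iff_subsingleton.1 fun hM => hL ⟨M, hM⟩
    ext v
    rw [Subsingleton.elim v 0, map_zero, map_zero]

end Uniqueness

end Slash

end

theorem lemma11 {O : Type u} [CommRing O] [IsDomain O] [IsPrincipalIdealRing O] [IsLocalRing O]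
    [IsAdicComplete (IsLocalRing.maximalIdeal O) O]
    [IsAlgClosed (IsLocalRing.ResidueField O)]
    (p : ℕ) [Fact p.Prime] [CharP (IsLocalRing.ResidueField O) p]
    {P : Type v} [Group P] [Finite P] (hP : IsPGroup p P)
    (𝓜 : ObjectProperty (Rep.{w} O P))
    (hfg : ∀ M : Rep.{w} O P, 𝓜 M → Module.Finite O M)
    (hM : ∀ V W : Rep.{w} O P,
      Slash.IsCappedIndecomposableSummand 𝓜 V → Slash.IsCappedIndecomposableSummand 𝓜 W →
        Slash.AreCompatibleEndopermutation V W) :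
    (∃ Sl : 𝓜.FullSubcategory ⥤ ModuleCat.{w} (IsLocalRing.ResidueField O),
      Slash.IsSlashFunctor Sl) ∧
    (∀ Sl Sl' : 𝓜.FullSubcategory ⥤ ModuleCat.{w} (IsLocalRing.ResidueField O),
      Slash.IsSlashFunctor Sl → Slash.IsSlashFunctor Sl' →
        Nonempty (Sl ≅ Sl') ∧
        ∀ ξ ξ' : Sl ≅ Sl', ∃ c : (IsLocalRing.ResidueField O)ˣ,
          ∀ M : 𝓜.FullSubcategory,
            ξ'.hom.app M = (c : IsLocalRing.ResidueField O) • ξ.hom.app M) := by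
  obtain ⟨V, hV, hL⟩ := Slash.exists_generator 𝓜 hfg hM
  exact ⟨⟨_, Slash.isSlashFunctor_brauerHomFunctor hV hL⟩, fun Sl Sl' h h' =>
    ⟨Slash.nonempty_iso_of_isSlashFunctor h h', Slash.iso_unique_up_to_scalar h⟩⟩
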